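/- Let $\nu$ be a finite Borel measure on $(0,1)$ and let $\Lambda$ be Lebesgue measure. For $n\ge 1$ and $q\in\mathbb R$ let $$\beta_n(q)=\frac{1}{\log 2^n}\log\sum_{C}\nu(C)^q,$$ where $C$ runs over the intervals $((k-1)2^{-n},k2^{-n}]$, $1\le k\le 2^n$, with $\nu(C)>0$, and let $\beta_\nu(q)=\limsup_{n\to\infty}\beta_n(q)$ be the $L^q$-spectrum of $\nu$. For $\nu\neq 0$ and all large $n$ the function $\beta_n$ has a unique fixed point $q_n$; put $\overline q_\nu=\limsup_{n\to\infty} q_n$. The measure $\nu$ is called $L^q$-regular if either there is $\varepsilon>0$ with $\beta_\nu(q)=\liminf_{n\to\infty}\beta_n(q)$ for all $q\in(\overline q_\nu-\varepsilon,\overline q_\nu)$, or $\beta_\nu(\overline q_\nu)=\liminf_{n\to\infty}\beta_n(\overline q_\nu)$ and $\beta_\nu$ is differentiable at $\overline q_\nu$. Let $H^1_0(0,1)$ be the space of functions $f:[0,1]\to\mathbb R$ with $f(0)=f(1)=0$ for which there is $\nabla f\in L^2([0,1],\Lambda)$ with $f(x)=\int_0^x\nabla f\,d\Lambda$ for all $x\in[0,1]$,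 and let $\mathcal D_\nu$ be the set of those $f\in H^1_0(0,1)$ that are affine linear on each connected component of $[0,1]\setminus\operatorname{supp}\nu$. A real number $\lambda$ is an eigenvalue (of the Kreĭn–Feller operator of $\nu$ with Dirichlet boundary conditions on $[0,1]$) if there is $f\in\mathcal D_\nu\setminus\{0\}$ with $$\int_{(0,1)}\nabla f\,\nabla g\,d\Lambda=\lambda\int fg\,d\nu\qquad\text{for all }g\in\mathcal D_\nu .$$ Let $N_\nu(x)$ be the number of eigenvalues $\le x$, counted with multiplicity, and define the lower and upper spectral dimensions of $\nu$ by $$\underline s_\nu=\liminf_{x\to\infty}\frac{\log N_\nu(x)}{\log x},\qquad \overline s_\nu=\limsup_{x\to\infty}\frac{\log N_\nu(x)}{\log x}.$$ If they coincide, their common value is called the spectral dimension of $\nu$. Suppose that the absolutely continuous part of $\nu$ with respect to $\Lambda$ is not zero. Then for every $q\in[0,1]$ the limit $\lim_{n\to\infty}\beta_n(q)$ exists and $$\beta_\nu(q)=\lim_{n\to\infty}\beta_n(q)=1-q .$$ In particular, $\nu$ is $L^q$-regular, and its spectral dimension exists and equals $1/2$. -/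

import Mathlib

open MeasureTheory Filter Topology Set
open scoped ENNReal

noncomputable section

namespace KreinFeller

/-! Throughout, a finite Borel measure on `(0,1)` is a finite measure `ν` on `ℝ` which gives
no mass to the complement of `(0,1)`.  A function on `[0,1]` that vanishes at `0` and `1` is
identified with its extension by zero to the real line. -/

/-- `g` is a weak derivative of `f` on `[0,1]`: `g ∈ L²([0,1])` and
`f x = f 0 + ∫_{[0,x]} g` for `x ∈ [0,1]`. -/
def IsWeakDeriv (f g : ℝ → ℝ) : Prop :=
  MemLp g 2 (volume.restrict (Icc 0 1)) ∧
    ∀ x ∈ Icc (0 : ℝ) 1, f x = f 0 + ∫ t in Icc 0 x, g t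

/-- The Sobolev space `H¹₀(0,1)` (functions extended by zero outside `(0,1)`). -/
def H10 : Set (ℝ → ℝ) :=
  {f | (∃ g, IsWeakDeriv f g) ∧ ∀ x, x ∉ Ioo (0 : ℝ) 1 → f x = 0}

open Classical in
/-- The weak derivative of `f` (unique up to Lebesgue null sets in `[0,1]`). -/
def weakDeriv (f : ℝ → ℝ) : ℝ → ℝ :=
  if h : ∃ g, IsWeakDeriv f g then h.choose else 0

/-- `f` is affine linear on every connected component of `[0,1] \ supp ν`. -/
def AffineOffSupport (ν : Measure ℝ) (f : ℝ → ℝ) : Prop :=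
  ∀ x ∈ Icc (0 : ℝ) 1 \ ν.support, ∃ m c : ℝ,
    ∀ y ∈ connectedComponentIn (Icc (0 : ℝ) 1 \ ν.support) x, f y = m * y + c

/-- The Dirichlet domain of the form: the functions in `H¹₀(0,1)` (these are continuous) that
are affine linear on the components of `[0,1] \ supp ν`. -/
def formDomain (ν : Measure ℝ) : Set (ℝ → ℝ) :=
  {f | f ∈ H10 ∧ AffineOffSupport ν f}

/-- The form `ℰ(f, g) = ∫_{(0,1)} ∇f ∇g dΛ`. -/
def energy (f g : ℝ → ℝ) : ℝ :=
  ∫ x in Ioo (0 : ℝ) 1, weakDeriv f x * weakDeriv g x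

/-- `f` is an eigenfunction, with eigenvalue `l`, of the form `ℰ_ν`, equivalently of the
Kreĭn-Feller operator `Δ_ν`, with Dirichlet boundary conditions on `[0,1]`. -/
def IsEigenfunction (ν : Measure ℝ) (l : ℝ) (f : ℝ → ℝ) : Prop :=
  f ∈ formDomain ν ∧ f ≠ 0 ∧
    ∀ g ∈ formDomain ν, energy f g = l * ∫ x, f x * g x ∂ν

/-- The multiplicity of `l`: the dimension of the space spanned by the eigenfunctions with
eigenvalue `l`; it is `0` if `l` is not an eigenvalue. -/
def multiplicity (ν : Measure ℝ) (l : ℝ) : ℕ∞ :=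
  Cardinal.toENat (Module.rank ℝ (Submodule.span ℝ {f | IsEigenfunction ν l f}))

/-- The eigenvalue counting function: the number of eigenvalues not exceeding `x`, counted
with multiplicity. -/
def eigenvalueCount (ν : Measure ℝ) (x : ℝ) : ℝ≥0∞ :=
  ∑' l : Iic x, ((multiplicity ν (l : ℝ) : ℕ∞) : ℝ≥0∞)

/-- The lower spectral dimension `liminf_{x → ∞} log N_ν(x) / log x`, with `log 0 = -∞`. -/
def lowerSpectralDim (ν : Measure ℝ) : EReal :=
  liminf (fun x : ℝ => ENNReal.log (eigenvalueCount ν x) / ((Real.log x : ℝ) : EReal)) atTop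

/-- The upper spectral dimension `limsup_{x → ∞} log N_ν(x) / log x`, with `log 0 = -∞`. -/
def upperSpectralDim (ν : Measure ℝ) : EReal :=
  limsup (fun x : ℝ => ENNReal.log (eigenvalueCount ν x) / ((Real.log x : ℝ) : EReal)) atTop

/-- The spectral dimension of `ν` exists and equals `s`. -/
def HasSpectralDim (ν : Measure ℝ) (s : ℝ) : Prop :=
  lowerSpectralDim ν = (s : EReal) ∧ upperSpectralDim ν = (s : EReal)

/-- The dyadic interval `((k-1)2⁻ⁿ, k2⁻ⁿ]`. -/
def dyadic (n k : ℕ) : Set ℝ :=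
  Ioc (((k : ℝ) - 1) / 2 ^ n) ((k : ℝ) / 2 ^ n)

open Classical in
/-- `β_n(q) = (log 2ⁿ)⁻¹ log ∑ ν(C)^q`, where `C` runs over the dyadic intervals of level `n`
in `(0,1]` with `ν(C) > 0` (meaningful for `n ≥ 1`). -/
def betaLevel (ν : Measure ℝ) (n : ℕ) (q : ℝ) : ℝ :=
  Real.log (∑ k ∈ (Finset.Icc 1 (2 ^ n)).filter (fun k => 0 < ν (dyadic n k)),
    (ν.real (dyadic n k)) ^ q) / Real.log (2 ^ n)

/-- The `L^q`-spectrum `β_ν(q) = limsup_n β_n(q)`. -/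
def lqSpectrum (ν : Measure ℝ) (q : ℝ) : EReal :=
  limsup (fun n : ℕ => ((betaLevel ν n q : ℝ) : EReal)) atTop

/-- `liminf_n β_n(q)`. -/
def lowerLqSpectrum (ν : Measure ℝ) (q : ℝ) : EReal :=
  liminf (fun n : ℕ => ((betaLevel ν n q : ℝ) : EReal)) atTop

/-- The fixed point of `β_n`.  For a nonzero finite measure on `(0,1)` it exists and is unique
as soon as `ν((0,1)) < 2ⁿ`, hence for all large `n`. -/
def fixedPoint (ν : Measure ℝ) (n : ℕ) : ℝ :=
  Classical.epsilon (fun q : ℝ => betaLevel ν n q = q)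

/-- `q̄_ν`, the limit superior of the fixed points of `β_n` (a bounded sequence if `ν` is a
nonzero finite measure on `(0,1)`). -/
def upperFixedPoint (ν : Measure ℝ) : ℝ :=
  limsup (fun n : ℕ => fixedPoint ν n) atTop

/-- The `L^q`-spectrum is finite near `q` and differentiable at `q`. -/
def LqSpectrumDifferentiableAt (ν : Measure ℝ) (q : ℝ) : Prop :=
  (∀ᶠ t in 𝓝 q, lqSpectrum ν t ≠ ⊤ ∧ lqSpectrum ν t ≠ ⊥) ∧
    DifferentiableAt ℝ (fun t => (lqSpectrum ν t).toReal) q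

/-- `L^q`-regularity: `β_ν = liminf_n β_n` on a left neighbourhood of `q̄_ν`, or at `q̄_ν`
itself with `β_ν` differentiable there. -/
def IsLqRegular (ν : Measure ℝ) : Prop :=
  (∃ ε > 0, ∀ q ∈ Ioo (upperFixedPoint ν - ε) (upperFixedPoint ν),
      lqSpectrum ν q = lowerLqSpectrum ν q) ∨
    (lqSpectrum ν (upperFixedPoint ν) = lowerLqSpectrum ν (upperFixedPoint ν) ∧
      LqSpectrumDifferentiableAt ν (upperFixedPoint ν))

end KreinFeller

end

/-! A nonzero absolutely continuous part gives a set `E ⊆ (0,1)` of positive Lebesgue measure and `c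
> 0` with `c Λ(B ∩ E) ≤ ν(B)` for all Borel `B` (`exists_lebesgue_minorant`). Everything else uses
only this minorant and the finiteness of `ν`.

For `q ∈ [0,1]` the moment sum over level `n` lies between constant multiples of `2^{n(1-q)}`
(`le_momentSum`, `momentSum_le`), so `β_n(q) → 1 - q`. Since `β_n(q) - q` is eventually strictly
decreasing in `q` and converges to `1 - 2q` on `[0,1]`, the fixed points tend to `1/2`, which gives
regularity.

For the spectrum, `H¹₀` is identified through `f ↦ ∇f` with the mean-zero part of `L²([0,1])`. Point
evaluation at `y` becomes the inner product with `kern y`, and the form `∫ f g dν` is represented by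
the compact symmetric operator `green ν = ∫ ⟪k_y, ·⟫ k_y dν(y)`. The positive eigenvalues of `green
ν` are reciprocals of eigenvalues of the Kreĭn–Feller problem, so `N_ν(x)` can be compared with `√x`
by variational arguments.

Upper bound: cut `[0,1]` into `m + 1` intervals whose lengths and inner `ν`-masses are at most a
constant over `m`. A combination of eigenfunctions with eigenvalues `≤ x` that vanishes at all cut
points is zero by a Poincaré inequality once `m` exceeds a multiple of `√x`, so `N_ν(x) ≤ m + 2`
(`sum_multiplicity_le`).

Lower bound: of `n` equal cells, a fixed proportion contains a good share of `E`. The tent functions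
on these cells are orthogonal for both forms and have Rayleigh quotient at least a constant over
`n²`, so `N_ν` at a multiple of `n²` is at least a multiple of `n` (`le_eigenvalueCount`). -/

open scoped RealInnerProductSpace

namespace KreinFeller

/-! ### The `L^q`-spectrum -/

/-- A measure on `(0,1)` with nonzero absolutely continuous part dominates a multiple of Lebesgue
measure on a set of positive Lebesgue measure. -/
theorem exists_lebesgue_minorant (ν : Measure ℝ) [IsFiniteMeasure ν]
    (hν : ν (Ioo (0 : ℝ) 1)ᶜ = 0) (hac : volume.withDensity (ν.rnDeriv volume) ≠ 0) :
    ∃ E ⊆ Ioo (0 : ℝ) 1, MeasurableSet E ∧ 0 < volume.real E ∧ ∃ c > 0,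
      ∀ B, MeasurableSet B → c * volume.real (B ∩ E) ≤ ν.real B := by
  have hm : Measurable (ν.rnDeriv volume) := Measure.measurable_rnDeriv _ _
  -- If all these superlevel sets were null, the density would vanish a.e. in `(0,1)`; outside it
  -- vanishes a.e. because `ν` has no mass there.
  set E : ℕ → Set ℝ := fun n => {x | ((n : ℝ≥0∞) + 1)⁻¹ ≤ ν.rnDeriv volume x} ∩ Ioo 0 1
  have hEm : ∀ n, MeasurableSet (E n) := fun n =>
    (measurableSet_le measurable_const hm).inter measurableSet_Ioo
  obtain ⟨n, hn⟩ : ∃ n, volume (E n) ≠ 0 := by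
    by_contra! h
    have h0 : ∀ᵐ x ∂volume, x ∈ Ioo (0 : ℝ) 1 → ν.rnDeriv volume x = 0 := by
      have : volume (⋃ n, E n) = 0 := measure_iUnion_null h
      filter_upwards [measure_eq_zero_iff_ae_notMem.1 this] with x hx hx1
      by_contra hne
      obtain ⟨n, hn⟩ := ENNReal.exists_inv_nat_lt hne
      refine hx (mem_iUnion.2 ⟨n, ?_, hx1⟩)
      exact (ENNReal.inv_le_inv.2 (by simp)).trans hn.le
    have h1 : ∫⁻ x in Ioo (0 : ℝ) 1, ν.rnDeriv volume x = 0 := by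
      rw [lintegral_eq_zero_iff hm]
      exact (ae_restrict_iff' measurableSet_Ioo).2 h0
    have h2 : ∫⁻ x in (Ioo (0 : ℝ) 1)ᶜ, ν.rnDeriv volume x = 0 :=
      le_antisymm ((Measure.setLIntegral_rnDeriv_le _).trans hν.le) zero_le
    apply hac
    rw [← Measure.measure_univ_eq_zero, withDensity_apply _ MeasurableSet.univ, setLIntegral_univ,
      ← lintegral_add_compl _ (measurableSet_Ioo (a := (0 : ℝ)) (b := 1)), h1, h2, add_zero]
  have hfin : ∀ s, volume (s ∩ E n) ≠ ∞ := fun s =>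
    ne_top_of_le_ne_top (by simp)
      (measure_mono (show s ∩ E n ⊆ Ioo (0 : ℝ) 1 from fun x hx => hx.2.2))
  refine ⟨E n, inter_subset_right, hEm n, ?_, ((n : ℝ) + 1)⁻¹, by positivity, fun B hB => ?_⟩
  · exact ENNReal.toReal_pos hn (by simpa using hfin univ)
  · have : ((n : ℝ≥0∞) + 1)⁻¹ * volume (B ∩ E n) ≤ ν B := by
      calc ((n : ℝ≥0∞) + 1)⁻¹ * volume (B ∩ E n)
          = ∫⁻ _ in B ∩ E n, ((n : ℝ≥0∞) + 1)⁻¹ := by simp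
        _ ≤ ∫⁻ x in B ∩ E n, ν.rnDeriv volume x :=
          setLIntegral_mono' (hB.inter (hEm n)) fun x hx => hx.2.1
        _ ≤ ν (B ∩ E n) := Measure.setLIntegral_rnDeriv_le _
        _ ≤ ν B := measure_mono inter_subset_left
    have h2 := ENNReal.toReal_mono (measure_ne_top ν B) this
    rw [ENNReal.toReal_mul, ENNReal.toReal_inv] at h2
    simpa [measureReal_def, ENNReal.toReal_add] using h2

theorem dyadic_eq (n k : ℕ) : dyadic n k = Ioc (((k : ℝ) - 1) / 2 ^ n) ((k : ℝ) / 2 ^ n) := rfl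

theorem measurableSet_dyadic (n k : ℕ) : MeasurableSet (dyadic n k) := measurableSet_Ioc

theorem pairwiseDisjoint_dyadic (n : ℕ) (s : Set ℕ) : s.PairwiseDisjoint (dyadic n) := by
  intro i _ j _ hij
  have key : ∀ {i j : ℕ}, i < j → Disjoint (dyadic n i) (dyadic n j) := by
    intro i j h
    rw [dyadic_eq, dyadic_eq, Set.disjoint_left]
    rintro x ⟨_, h1⟩ ⟨h2, _⟩
    have : (i : ℝ) ≤ j - 1 := by
      have : (i : ℝ) + 1 ≤ j := by exact_mod_cast h
      linarith
    have : (i : ℝ) / 2 ^ n ≤ (j - 1) / 2 ^ n := by gcongr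
    linarith
  rcases lt_or_gt_of_ne hij with h | h
  · exact key h
  · exact (key h).symm

theorem Ioc_subset_iUnion_dyadic (n : ℕ) :
    Ioc (0 : ℝ) 1 ⊆ ⋃ k ∈ Finset.Icc 1 (2 ^ n), dyadic n k := by
  intro x hx
  have h2 : (0 : ℝ) < 2 ^ n := by positivity
  have hpos : 0 < x * 2 ^ n := mul_pos hx.1 h2
  refine mem_iUnion₂.2 ⟨⌈x * 2 ^ n⌉₊, ?_, ?_⟩
  · rw [Finset.mem_Icc]
    refine ⟨Nat.one_le_iff_ne_zero.2 (Nat.ceil_pos.2 hpos).ne', Nat.ceil_le.2 ?_⟩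
    push_cast
    nlinarith [hx.2]
  · constructor
    · rw [div_lt_iff₀ h2]
      have := Nat.ceil_lt_add_one hpos.le
      linarith
    · rw [le_div_iff₀ h2]
      exact Nat.le_ceil _

section Moments

variable (ν : Measure ℝ)

open Classical in
/-- The indices of the dyadic intervals of level `n` with positive measure. -/
noncomputable def chargedIndices (n : ℕ) : Finset ℕ :=
  (Finset.Icc 1 (2 ^ n)).filter (fun k => 0 < ν (dyadic n k))

/-- The `q`-th moment sum of `ν` over the dyadic intervals of level `n`. -/
noncomputable def momentSum (n : ℕ) (q : ℝ) : ℝ :=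
  ∑ k ∈ chargedIndices ν n, (ν.real (dyadic n k)) ^ q

theorem betaLevel_eq (n : ℕ) (q : ℝ) :
    betaLevel ν n q = Real.log (momentSum ν n q) / (n * Real.log 2) := by
  rw [← Real.log_pow]; rfl

variable {ν}

/-- A cell meets `E` in measure `x ≤ 2⁻ⁿ`, hence `x^q = x · x^{q-1} ≥ x · 2^{n(1-q)}` when `x > 0`;
summing the `x` recovers at least `Λ(E)`. -/
theorem le_momentSum {E : Set ℝ} (hE : E ⊆ Ioo 0 1) {c : ℝ} (hc : 0 < c)
    (h : ∀ B, MeasurableSet B → c * volume.real (B ∩ E) ≤ ν.real B) (n : ℕ) {q : ℝ}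
    (hq : q ∈ Icc (0 : ℝ) 1) :
    c ^ q * volume.real E * (2 ^ n : ℝ) ^ (1 - q) ≤ momentSum ν n q := by
  classical
  have h2 : (0 : ℝ) < 2 ^ n := by positivity
  have hfin : ∀ s, volume (s ∩ E) ≠ ∞ := fun s =>
    ne_top_of_le_ne_top (by simp)
      (measure_mono (show s ∩ E ⊆ Ioo (0 : ℝ) 1 from fun x hx => hE hx.2))
  have hcover : volume.real E ≤ ∑ k ∈ Finset.Icc 1 (2 ^ n), volume.real (dyadic n k ∩ E) := by
    refine (measureReal_mono (s₂ := ⋃ k ∈ Finset.Icc 1 (2 ^ n), dyadic n k ∩ E) ?_ ?_).trans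
      (measureReal_biUnion_finset_le _ _)
    · intro x hx
      have := Ioc_subset_iUnion_dyadic n (Ioo_subset_Ioc_self (hE hx))
      simp only [mem_iUnion] at this ⊢
      obtain ⟨k, hk, hxk⟩ := this
      exact ⟨k, hk, hxk, hx⟩
    · rw [← iUnion₂_inter]; exact hfin _
  -- Cells without `ν`-mass meet `E` in a null set by the minorant, so dropping them loses nothing.
  have hsum : ∑ k ∈ Finset.Icc 1 (2 ^ n), volume.real (dyadic n k ∩ E)
      = ∑ k ∈ chargedIndices ν n, volume.real (dyadic n k ∩ E) := by
    refine (Finset.sum_subset (Finset.filter_subset _ _) fun k hk hk' => ?_).symm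
    have : ν (dyadic n k) = 0 := by
      by_contra hne
      exact hk' (Finset.mem_filter.2 ⟨hk, pos_iff_ne_zero.2 hne⟩)
    have h1 := h _ (measurableSet_dyadic n k)
    rw [measureReal_def ν, this, ENNReal.toReal_zero] at h1
    exact le_antisymm (nonpos_of_mul_nonpos_right h1 hc) measureReal_nonneg
  rw [hsum] at hcover
  refine (mul_le_mul_of_nonneg_right (mul_le_mul_of_nonneg_left hcover (by positivity))
    (by positivity)).trans ?_
  rw [Finset.mul_sum, Finset.sum_mul]
  refine Finset.sum_le_sum fun k hk => ?_
  set x := volume.real (dyadic n k ∩ E)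
  have hx0 : 0 ≤ x := measureReal_nonneg
  have hx : x ≤ (2 ^ n : ℝ)⁻¹ := by
    refine (measureReal_mono inter_subset_left (by simp [dyadic_eq])).trans_eq ?_
    rw [dyadic_eq, Real.volume_real_Ioc_of_le (by gcongr; linarith)]
    ring
  have h3 : x * (2 ^ n : ℝ) ^ (1 - q) ≤ x ^ q := by
    rcases hx0.eq_or_lt with h0 | h0
    · rw [← h0, zero_mul]; exact Real.rpow_nonneg le_rfl _
    · have e2 : x ^ q = x * x⁻¹ ^ (1 - q) := by
        rw [Real.inv_rpow h0.le, Real.rpow_sub h0, Real.rpow_one]; field_simp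
      rw [e2]
      have : 2 ^ n ≤ x⁻¹ := (le_inv_comm₀ h0 h2).1 hx
      gcongr
      linarith [hq.2]
  calc c ^ q * x * (2 ^ n : ℝ) ^ (1 - q) = c ^ q * (x * (2 ^ n : ℝ) ^ (1 - q)) := by ring
    _ ≤ c ^ q * x ^ q := by gcongr
    _ = (c * x) ^ q := (Real.mul_rpow hc.le hx0).symm
    _ ≤ _ := Real.rpow_le_rpow (by positivity) (h _ (measurableSet_dyadic n k)) hq.1

variable (ν) [IsFiniteMeasure ν]

theorem real_dyadic_pos {n k : ℕ} (hk : k ∈ chargedIndices ν n) : 0 < ν.real (dyadic n k) := by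
  classical
  exact ENNReal.toReal_pos (Finset.mem_filter.1 hk).2.ne' (measure_ne_top _ _)

/-- Each mass `x` satisfies `x^q ≤ max(x, 2⁻ⁿ) · 2^{n(1-q)}`. Bounding the maximum by the sum, the
`2⁻ⁿ` add up to at most `1` and the masses to at most the total mass. -/
theorem momentSum_le (n : ℕ) {q : ℝ} (hq : q ∈ Icc (0 : ℝ) 1) :
    momentSum ν n q ≤ (1 + ν.real univ) * (2 ^ n : ℝ) ^ (1 - q) := by
  classical
  have h2 : (0 : ℝ) < 2 ^ n := by positivity
  have hterm : ∀ k ∈ chargedIndices ν n, (ν.real (dyadic n k)) ^ q ≤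
      ((2 ^ n : ℝ)⁻¹ + ν.real (dyadic n k)) * (2 ^ n : ℝ) ^ (1 - q) := by
    intro k hk
    have hx := real_dyadic_pos ν hk
    set x := ν.real (dyadic n k)
    have hpow : 0 < (2 ^ n : ℝ) ^ (1 - q) := by positivity
    have e1 : (2 ^ n : ℝ)⁻¹ ^ q = (2 ^ n : ℝ)⁻¹ * (2 ^ n : ℝ) ^ (1 - q) := by
      rw [Real.inv_rpow h2.le, Real.rpow_sub h2, Real.rpow_one]; field_simp
    rcases le_total x (2 ^ n : ℝ)⁻¹ with h | h
    · calc x ^ q ≤ (2 ^ n : ℝ)⁻¹ ^ q := Real.rpow_le_rpow hx.le h hq.1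
        _ = (2 ^ n : ℝ)⁻¹ * (2 ^ n : ℝ) ^ (1 - q) := e1
        _ ≤ _ := by gcongr; linarith
    · have e2 : x ^ q = x * x⁻¹ ^ (1 - q) := by
        rw [Real.inv_rpow hx.le, Real.rpow_sub hx, Real.rpow_one]; field_simp
      rw [e2]
      have : x⁻¹ ≤ 2 ^ n := inv_le_of_inv_le₀ h2 h
      calc x * x⁻¹ ^ (1 - q) ≤ x * (2 ^ n : ℝ) ^ (1 - q) := by
            gcongr; linarith [hq.2]
        _ ≤ _ := by gcongr; linarith [inv_pos.2 h2]
  refine (Finset.sum_le_sum hterm).trans ?_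
  rw [← Finset.sum_mul, Finset.sum_add_distrib]
  gcongr
  · have hc : ((chargedIndices ν n).card : ℝ) ≤ 2 ^ n := by
      have : (chargedIndices ν n).card ≤ 2 ^ n := (Finset.card_filter_le _ _).trans (by simp)
      exact_mod_cast this
    rw [Finset.sum_const, nsmul_eq_mul, ← div_eq_mul_inv]
    exact div_le_one_of_le₀ hc h2.le
  · rw [← measureReal_biUnion_finset (pairwiseDisjoint_dyadic n _)
      (fun k _ => measurableSet_dyadic n k)]
    exact measureReal_mono (subset_univ _)

variable {ν}

theorem tendsto_betaLevel (hν : ν (Ioo (0 : ℝ) 1)ᶜ = 0)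
    (hac : volume.withDensity (ν.rnDeriv volume) ≠ 0) {q : ℝ} (hq : q ∈ Icc (0 : ℝ) 1) :
    Tendsto (fun n : ℕ => betaLevel ν n q) atTop (𝓝 (1 - q)) := by
  obtain ⟨E, hE, -, hE0, c, hc, h⟩ := exists_lebesgue_minorant ν hν hac
  have hl2 : 0 < Real.log 2 := Real.log_pos one_lt_two
  have hlim : ∀ C : ℝ, Tendsto (fun n : ℕ => C / (n * Real.log 2) + (1 - q)) atTop (𝓝 (1 - q)) := by
    intro C
    have : Tendsto (fun n : ℕ => (n : ℝ) * Real.log 2) atTop atTop :=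
      tendsto_natCast_atTop_atTop.atTop_mul_const hl2
    simpa using (this.const_div_atTop C).add_const (1 - q)
  have key : ∀ n : ℕ, ∀ C : ℝ, 0 < n → 0 < C →
      Real.log (C * (2 ^ n : ℝ) ^ (1 - q)) / (n * Real.log 2)
        = Real.log C / (n * Real.log 2) + (1 - q) := by
    intro n C hn hC
    rw [Real.log_mul hC.ne' (by positivity), Real.log_rpow (by positivity), Real.log_pow]
    field_simp
  have hC : 0 < c ^ q * volume.real E := by positivity
  refine tendsto_of_tendsto_of_tendsto_of_le_of_le' (hlim (Real.log (c ^ q * volume.real E)))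
    (hlim (Real.log (1 + ν.real univ))) ?_ ?_
  · filter_upwards [eventually_gt_atTop 0] with n hn
    rw [betaLevel_eq, ← key n _ hn hC]
    gcongr
    exact le_momentSum hE hc h n hq
  · filter_upwards [eventually_gt_atTop 0] with n hn
    rw [betaLevel_eq, ← key n _ hn (by positivity)]
    have := le_momentSum hE hc h n hq
    have h0 : 0 < momentSum ν n q := lt_of_lt_of_le (by positivity) this
    gcongr
    exact momentSum_le ν n hq

/-! ### Fixed points of `β_n` and regularity -/

theorem momentSum_pos {n : ℕ} (hne : (chargedIndices ν n).Nonempty) (q : ℝ) :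
    0 < momentSum ν n q :=
  Finset.sum_pos (fun _ hk => Real.rpow_pos_of_pos (real_dyadic_pos ν hk) q) hne

/-- All masses are below `2ⁿ`, so passing from exponent `q` to `r > q` multiplies every summand by
less than `2^{n(r-q)}`; thus `β_n` has all difference quotients below `1`. -/
theorem strictAnti_betaLevel_sub {n : ℕ} (hn : 0 < n) (hM : ν.real univ < 2 ^ n)
    (hne : (chargedIndices ν n).Nonempty) : StrictAnti fun q => betaLevel ν n q - q := by
  intro q r hqr
  have hl2 : 0 < Real.log 2 := Real.log_pos one_lt_two
  have h1 : momentSum ν n r < momentSum ν n q * (2 ^ n : ℝ) ^ (r - q) := by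
    rw [momentSum, momentSum, Finset.sum_mul]
    refine Finset.sum_lt_sum_of_nonempty hne fun k hk => ?_
    have hx := real_dyadic_pos ν hk
    set x := ν.real (dyadic n k)
    have hx2 : x < 2 ^ n := (measureReal_mono (subset_univ _)).trans_lt hM
    have e : x ^ r = x ^ q * x ^ (r - q) := by rw [← Real.rpow_add hx]; congr 1; ring
    rw [e]
    have := Real.rpow_lt_rpow hx.le hx2 (sub_pos.2 hqr)
    gcongr
  have h2 := Real.log_lt_log (momentSum_pos hne r) h1
  rw [Real.log_mul (momentSum_pos hne q).ne' (by positivity), Real.log_rpow (by positivity),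
    Real.log_pow] at h2
  have hn' : (0 : ℝ) < n := by exact_mod_cast hn
  have h3 : betaLevel ν n r < betaLevel ν n q + (r - q) := by
    rw [betaLevel_eq, betaLevel_eq, div_add' _ _ _ (by positivity)]
    gcongr
  simp only
  linarith

theorem continuous_betaLevel {n : ℕ} (hne : (chargedIndices ν n).Nonempty) :
    Continuous fun q => betaLevel ν n q := by
  simp only [betaLevel_eq]
  refine Continuous.div_const (Continuous.log ?_ fun q => (momentSum_pos hne q).ne') _
  refine continuous_finsetSum _ fun k hk => ?_
  exact Real.continuous_const_rpow (real_dyadic_pos ν hk).ne'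

theorem tendsto_fixedPoint (hν : ν (Ioo (0 : ℝ) 1)ᶜ = 0)
    (hac : volume.withDensity (ν.rnDeriv volume) ≠ 0) :
    Tendsto (fun n : ℕ => fixedPoint ν n) atTop (𝓝 (1 / 2)) := by
  obtain ⟨E, hE, -, hE0, c, hc, h⟩ := exists_lebesgue_minorant ν hν hac
  have hne : ∀ n, (chargedIndices ν n).Nonempty := by
    intro n
    rw [Finset.nonempty_iff_ne_empty]
    intro h0
    have := le_momentSum hE hc h n (q := 0) (by simp)
    rw [momentSum, h0, Finset.sum_empty] at this
    have h3 : 0 < c ^ (0 : ℝ) * volume.real E * (2 ^ n : ℝ) ^ (1 - (0 : ℝ)) := by positivity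
    linarith
  rw [Metric.tendsto_nhds]
  intro ε' hε'
  -- Shrinking `ε` below `1/2` keeps both test points `1/2 ± ε` in `[0,1]`, where the limit of `β_n`
  -- is known.
  obtain ⟨ε, hε, hεε', hε2⟩ : ∃ ε > 0, ε < ε' ∧ ε < 1 / 2 :=
    ⟨min ε' (1 / 2) / 2, by positivity,
      by linarith [min_le_left ε' (1 / 2), lt_min hε' one_half_pos],
      by linarith [min_le_right ε' (1 / 2), lt_min hε' one_half_pos]⟩
  have hl := (tendsto_betaLevel hν hac (q := 1 / 2 - ε) ⟨by linarith, by linarith⟩)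
    |>.eventually_const_lt (u := 1 / 2 - ε) (by linarith)
  have hr := (tendsto_betaLevel hν hac (q := 1 / 2 + ε) ⟨by linarith, by linarith⟩)
    |>.eventually_lt_const (u := 1 / 2 + ε) (by linarith)
  have hbig : ∀ᶠ n : ℕ in atTop, ν.real univ < 2 ^ n :=
    (tendsto_pow_atTop_atTop_of_one_lt one_lt_two).eventually_gt_atTop _
  filter_upwards [hl, hr, hbig, eventually_gt_atTop 0] with n hl hr hM hn
  have hanti := strictAnti_betaLevel_sub hn hM (hne n)
  have hex : ∃ q, betaLevel ν n q = q := by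
    have hcont : Continuous fun q => betaLevel ν n q - q :=
      (continuous_betaLevel (hne n)).sub continuous_id
    obtain ⟨q, hq⟩ := mem_range_of_exists_le_of_exists_ge hcont (c := 0)
      ⟨1 / 2 + ε, by linarith⟩ ⟨1 / 2 - ε, by linarith⟩
    exact ⟨q, by simpa [sub_eq_zero] using hq⟩
  have hfix : betaLevel ν n (fixedPoint ν n) = fixedPoint ν n := Classical.epsilon_spec hex
  have h1 : 1 / 2 - ε < fixedPoint ν n := by
    rw [← hanti.lt_iff_gt]; linarith
  have h2 : fixedPoint ν n < 1 / 2 + ε := by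
    rw [← hanti.lt_iff_gt]; linarith
  rw [Real.dist_eq, abs_lt]
  constructor <;> linarith

theorem tendsto_coe_betaLevel (hν : ν (Ioo (0 : ℝ) 1)ᶜ = 0)
    (hac : volume.withDensity (ν.rnDeriv volume) ≠ 0) {q : ℝ} (hq : q ∈ Icc (0 : ℝ) 1) :
    Tendsto (fun n : ℕ => ((betaLevel ν n q : ℝ) : EReal)) atTop (𝓝 ((1 - q : ℝ) : EReal)) :=
  (continuous_coe_real_ereal.tendsto _).comp (tendsto_betaLevel hν hac hq)

theorem isLqRegular (hν : ν (Ioo (0 : ℝ) 1)ᶜ = 0)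
    (hac : volume.withDensity (ν.rnDeriv volume) ≠ 0) : IsLqRegular ν := by
  have h : upperFixedPoint ν = 1 / 2 := (tendsto_fixedPoint hν hac).limsup_eq
  refine Or.inl ⟨1 / 2, by norm_num, fun q hq => ?_⟩
  rw [h] at hq
  have ht := tendsto_coe_betaLevel hν hac (q := q) ⟨by linarith [hq.1], by linarith [hq.2]⟩
  exact ht.limsup_eq.trans ht.liminf_eq.symm

end Moments

/-! ### The Hilbert space of derivatives and its reproducing kernel -/

/-- The Hilbert space `L²([0,1])` containing the weak derivatives. -/
abbrev L2 : Type := Lp ℝ 2 ((volume : Measure ℝ).restrict (Icc 0 1))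

/-- The indicator function of `[0,y]`, as an element of `L²([0,1])`. -/
noncomputable def ind (y : ℝ) : L2 :=
  indicatorConstLp 2 (measurableSet_Icc (a := 0) (b := y))
    (measure_ne_top (volume.restrict (Icc (0 : ℝ) 1)) _) (1 : ℝ)

/-- The derivative `t ↦ ind y t - y` of the Green function of the Dirichlet problem on `[0,1]`
with pole `y`. -/
noncomputable def kern (y : ℝ) : L2 := ind y - y • ind 1

theorem inner_ind {y : ℝ} (hy : y ≤ 1) (u : L2) : ⟪ind y, u⟫ = ∫ t in Icc 0 y, u t := by
  rw [ind, MeasureTheory.L2.inner_indicatorConstLp_one, Measure.restrict_restrict measurableSet_Icc,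
    Icc_inter_Icc, max_self, min_eq_left hy]

theorem inner_ind_ind {x y : ℝ} (hx : x ∈ Icc (0 : ℝ) 1) (hy : y ∈ Icc (0 : ℝ) 1) :
    ⟪ind x, ind y⟫ = min x y := by
  rw [ind, ind, MeasureTheory.L2.real_inner_indicatorConstLp_one_indicatorConstLp_one,
    measureReal_restrict_apply (measurableSet_Icc.inter measurableSet_Icc), Icc_inter_Icc,
    Icc_inter_Icc, Real.volume_real_Icc_of_le] <;>
  simp [hx.1, hx.2, hy.1, hy.2]

/-- The right side is the Dirichlet Green function of `-d²/dx²` on `[0,1]`, the reproducing kernel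
of `H¹₀`. -/
theorem inner_kern_kern {x y : ℝ} (hx : x ∈ Icc (0 : ℝ) 1) (hy : y ∈ Icc (0 : ℝ) 1) :
    ⟪kern x, kern y⟫ = min x y - x * y := by
  have h1 : (1 : ℝ) ∈ Icc (0 : ℝ) 1 := by simp
  simp only [kern, inner_sub_left, inner_sub_right, real_inner_smul_left, real_inner_smul_right,
    inner_ind_ind hx hy, inner_ind_ind hx h1, inner_ind_ind h1 hy, inner_ind_ind h1 h1,
    min_eq_left hx.2, min_eq_right hy.2, min_self]
  ring

theorem inner_one_kern {x : ℝ} (hx : x ∈ Icc (0 : ℝ) 1) : ⟪ind 1, kern x⟫ = 0 := by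
  have h1 : (1 : ℝ) ∈ Icc (0 : ℝ) 1 := by simp
  simp only [kern, inner_sub_right, real_inner_smul_right,
    inner_ind_ind h1 hx, inner_ind_ind h1 h1, min_eq_right hx.2, min_self]
  ring

theorem continuous_ind : Continuous ind := by
  refine continuous_indicatorConstLp_set (by simp) fun x => ?_
  have hb : ∀ y, volume.restrict (Icc 0 1) (symmDiff (Icc 0 y) (Icc 0 x)) ≤ ENNReal.ofReal |y - x| := by
    intro y
    refine (Measure.restrict_apply_le _ _).trans ?_
    refine (measure_mono (t := uIcc x y) ?_).trans_eq (Real.volume_interval)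
    rintro z (⟨⟨h1, h2⟩, h3⟩ | ⟨⟨h1, h2⟩, h3⟩)
    · simp only [mem_Icc, not_and, not_le] at h3
      exact mem_uIcc.2 (Or.inl ⟨(h3 h1).le, h2⟩)
    · simp only [mem_Icc, not_and, not_le] at h3
      exact mem_uIcc.2 (Or.inr ⟨(h3 h1).le, h2⟩)
  refine tendsto_of_tendsto_of_tendsto_of_le_of_le tendsto_const_nhds ?_ (fun _ => zero_le) hb
  have : Continuous fun y : ℝ => ENNReal.ofReal |y - x| :=
    ENNReal.continuous_ofReal.comp (by fun_prop)
  simpa using this.tendsto x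

theorem continuous_kern : Continuous kern :=
  continuous_ind.sub (continuous_id.smul continuous_const)

theorem norm_kern_le {x : ℝ} (hx : x ∈ Icc (0 : ℝ) 1) : ‖kern x‖ ≤ 1 := by
  have h := inner_kern_kern hx hx
  rw [real_inner_self_eq_norm_sq, min_self] at h
  nlinarith [hx.1, hx.2, norm_nonneg (kern x)]

theorem kern_zero : kern 0 = 0 := by
  have h := inner_kern_kern (x := 0) (y := 0) (by simp) (by simp)
  simpa using h

theorem kern_one : kern 1 = 0 := by simp [kern]

/-- The function on `[0,1]` vanishing at the endpoints whose derivative is `u` minus its mean. -/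
noncomputable def primitive : L2 →ₗ[ℝ] (ℝ → ℝ) where
  toFun u := (Icc (0 : ℝ) 1).indicator fun y => ⟪kern y, u⟫
  map_add' u v := by ext y; by_cases hy : y ∈ Icc (0 : ℝ) 1 <;> simp [hy, inner_add_right]
  map_smul' a u := by ext y; by_cases hy : y ∈ Icc (0 : ℝ) 1 <;> simp [hy, real_inner_smul_right]

theorem primitive_apply {y : ℝ} (hy : y ∈ Icc (0 : ℝ) 1) (u : L2) :
    primitive u y = ⟪kern y, u⟫ :=
  indicator_of_mem (f := fun y => ⟪kern y, u⟫) hy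

theorem primitive_apply_of_notMem {y : ℝ} (hy : y ∉ Ioo (0 : ℝ) 1) (u : L2) :
    primitive u y = 0 := by
  by_cases h : y ∈ Icc (0 : ℝ) 1
  · rw [primitive_apply h]
    rcases eq_endpoints_or_mem_Ioo_of_mem_Icc h with rfl | rfl | h'
    · simp [kern_zero]
    · simp [kern_one]
    · exact absurd h' hy
  · exact indicator_of_notMem (f := fun y => ⟪kern y, u⟫) h

theorem primitive_eq_integral {u : L2} (hu : ⟪ind 1, u⟫ = 0) {x : ℝ} (hx : x ∈ Icc (0 : ℝ) 1) :
    primitive u x = ∫ t in Icc 0 x, u t := by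
  rw [primitive_apply hx, kern, inner_sub_left, real_inner_smul_left, hu, mul_zero, sub_zero,
    inner_ind hx.2]

theorem isWeakDeriv_primitive {u : L2} (hu : ⟪ind 1, u⟫ = 0) : IsWeakDeriv (primitive u) u := by
  refine ⟨Lp.memLp u, fun x hx => ?_⟩
  rw [primitive_eq_integral hu hx, primitive_apply_of_notMem (by simp), zero_add]

theorem primitive_mem_H10 {u : L2} (hu : ⟪ind 1, u⟫ = 0) : primitive u ∈ H10 :=
  ⟨⟨u, isWeakDeriv_primitive hu⟩, fun _ hx => primitive_apply_of_notMem hx u⟩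

/-- A square integrable function with vanishing primitive vanishes. -/
theorem eq_zero_of_forall_inner_ind {u : L2} (h : ∀ x ∈ Icc (0 : ℝ) 1, ⟪ind x, u⟫ = 0) : u = 0 := by
  have hint : Integrable u (volume.restrict (Icc 0 1)) := (Lp.memLp u).integrable (by norm_num)
  have htot : ∫ t, u t ∂volume.restrict (Icc 0 1) = 0 := by rw [← inner_ind le_rfl, h 1 (by simp)]
  suffices hs : ∀ s, MeasurableSet s → ∫ t in s, u t ∂volume.restrict (Icc 0 1) = 0 by
    rw [Lp.eq_zero_iff_ae_eq_zero]
    exact hint.ae_eq_zero_of_forall_setIntegral_eq_zero fun s hsm _ => hs s hsm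
  intro s hs
  -- The half-lines `Iic x` form a generating π-system, and their traces on `[0,1]` are empty or of
  -- the form `[0, min x 1]`, where the hypothesis applies.
  induction s, hs using MeasurableSpace.induction_on_inter
    (borel_eq_generateFrom_Iic ℝ ▸ BorelSpace.measurable_eq (α := ℝ)) isPiSystem_Iic with
  | empty => simp
  | basic s hs =>
    obtain ⟨x, rfl⟩ := hs
    rw [Measure.restrict_restrict measurableSet_Iic]
    rcases lt_or_ge x 0 with hx | hx
    · have : Iic x ∩ Icc (0 : ℝ) 1 = ∅ := by
        ext t; simp only [mem_inter_iff, mem_Iic, mem_Icc, mem_empty_iff_false, iff_false]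
        intro ht; linarith [ht.1, ht.2.1]
      simp [this]
    · have : Iic x ∩ Icc (0 : ℝ) 1 = Icc 0 (min x 1) := by
        ext t; simp only [mem_inter_iff, mem_Iic, mem_Icc, le_min_iff]; tauto
      rw [this, ← inner_ind (min_le_right _ _)]
      exact h _ ⟨by positivity, min_le_right _ _⟩
  | compl s hs ih =>
    rw [setIntegral_compl hs hint, ih, htot, sub_zero]
  | iUnion f hd hm ih =>
    rw [integral_iUnion hm hd hint.integrableOn]
    simp [ih]

/-- The chosen derivative and `u` have the same integrals over all `[0,x]`, which determines them up
to a null set. -/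
theorem weakDeriv_ae_eq {f : ℝ → ℝ} {u : L2} (h : IsWeakDeriv f u) :
    weakDeriv f =ᵐ[volume.restrict (Icc 0 1)] u := by
  have hex : ∃ g, IsWeakDeriv f g := ⟨_, h⟩
  have hd : weakDeriv f = hex.choose := by rw [weakDeriv, dif_pos hex]
  obtain ⟨h1, h2⟩ := hex.choose_spec
  rw [hd]
  set g := hex.choose
  have hz : h1.toLp g - u = 0 := by
    refine eq_zero_of_forall_inner_ind fun x hx => ?_
    rw [inner_sub_right, inner_ind hx.2, inner_ind hx.2, sub_eq_zero]
    have e1 : ∫ t in Icc 0 x, h1.toLp g t = ∫ t in Icc 0 x, g t :=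
      setIntegral_congr_ae measurableSet_Icc (by
        have := (ae_restrict_iff' measurableSet_Icc).1 h1.coeFn_toLp
        filter_upwards [this] with t ht htx using ht ⟨htx.1, htx.2.trans hx.2⟩)
    have := h2 x hx
    rw [h.2 x hx] at this
    rw [e1]; linarith
  rw [sub_eq_zero] at hz
  exact h1.coeFn_toLp.symm.trans (by rw [hz])

/-- The mean of `∇f` is `f 1 - f 0 = 0`. With `primitive_mem_H10` this identifies `H¹₀` with the
orthogonal complement of the constants in `L²([0,1])`. -/
theorem exists_primitive_eq {f : ℝ → ℝ} (hf : f ∈ H10) :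
    ∃ u : L2, ⟪ind 1, u⟫ = 0 ∧ f = primitive u := by
  obtain ⟨⟨g, hg, hfg⟩, hz⟩ := hf
  have h0 : f 0 = 0 := hz 0 (by simp)
  have h1 : f 1 = 0 := hz 1 (by simp)
  have e1 : ∀ x ∈ Icc (0 : ℝ) 1, ⟪ind x, hg.toLp g⟫ = f x := fun x hx => by
    rw [inner_ind hx.2, hfg x hx, h0, zero_add]
    exact setIntegral_congr_ae measurableSet_Icc (by
        have := (ae_restrict_iff' measurableSet_Icc).1 hg.coeFn_toLp
        filter_upwards [this] with t ht htx using ht ⟨htx.1, htx.2.trans hx.2⟩)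
  have hm : ⟪ind 1, hg.toLp g⟫ = 0 := by rw [e1 1 (by simp), h1]
  refine ⟨hg.toLp g, hm, funext fun x => ?_⟩
  by_cases hx : x ∈ Ioo (0 : ℝ) 1
  · have hx' := Ioo_subset_Icc_self hx
    rw [primitive_eq_integral hm hx', ← inner_ind hx.2.le, e1 x hx']
  · rw [hz x hx, primitive_apply_of_notMem hx]

theorem energy_primitive {u v : L2} (hu : ⟪ind 1, u⟫ = 0) (hv : ⟪ind 1, v⟫ = 0) :
    energy (primitive u) (primitive v) = ⟪u, v⟫ := by
  rw [energy, restrict_Ioo_eq_restrict_Icc, MeasureTheory.L2.inner_def]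
  refine integral_congr_ae ?_
  filter_upwards [weakDeriv_ae_eq (isWeakDeriv_primitive hu),
    weakDeriv_ae_eq (isWeakDeriv_primitive hv)] with x h1 h2
  rw [h1, h2, RCLike.inner_apply, conj_trivial, mul_comm]

/-! ### Variational lower bounds for eigenvalues of compact symmetric operators -/

section Compact

variable {H : Type*} [NormedAddCommGroup H] [InnerProductSpace ℝ H] [CompleteSpace H]
  {T : H →L[ℝ] H}

open Module.End in
-- By the spectral theorem finite sums of eigenvectors are dense; on them the form is diagonal, and
-- the inequality is a closed condition.
theorem inner_apply_self_le_of_forall_eigenvalue_le (hT : IsCompactOperator T)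
    (hT' : (T : H →ₗ[ℝ] H).IsSymmetric) {c : ℝ}
    (h : ∀ μ, HasEigenvalue (T : Module.End ℝ H) μ → μ ≤ c) (u : H) :
    ⟪T u, u⟫ ≤ c * ‖u‖ ^ 2 := by
  have hdense : (⨆ μ, eigenspace (T : Module.End ℝ H) μ).topologicalClosure = ⊤ :=
    Submodule.topologicalClosure_eq_top_iff.2
      (ContinuousLinearMap.orthogonalComplement_iSup_eigenspaces_eq_bot hT hT')
  have hclosed : IsClosed {u : H | ⟪T u, u⟫ ≤ c * ‖u‖ ^ 2} :=
    isClosed_le (by fun_prop) (by fun_prop)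
  have hmem : u ∈ closure ((⨆ μ, eigenspace (T : Module.End ℝ H) μ : Submodule ℝ H) : Set H) := by
    rw [← Submodule.topologicalClosure_coe, hdense]; trivial
  refine closure_minimal (fun v hv => ?_) hclosed hmem
  obtain ⟨f, hf, rfl⟩ := (Submodule.mem_iSup_iff_exists_finsupp _ _).1 hv
  have hTf : ∀ μ, T (f μ) = μ • f μ := fun μ => mem_eigenspace_iff.1 (hf μ)
  have horth : ∀ μ ν, μ ≠ ν → ⟪f μ, f ν⟫ = 0 := fun μ ν hne =>
    hT'.orthogonalFamily_eigenspaces hne ⟨f μ, hf μ⟩ ⟨f ν, hf ν⟩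
  have hsum : ∀ a : ℝ → ℝ, ⟪∑ μ ∈ f.support, a μ • f μ, ∑ μ ∈ f.support, f μ⟫
      = ∑ μ ∈ f.support, a μ * ‖f μ‖ ^ 2 := by
    intro a
    rw [sum_inner]
    refine Finset.sum_congr rfl fun μ hμ => ?_
    rw [inner_sum, Finset.sum_eq_single_of_mem μ hμ fun ν _ hne => ?_, real_inner_smul_left,
      real_inner_self_eq_norm_sq]
    rw [real_inner_smul_left, horth μ ν hne.symm, mul_zero]
  have h1 : ‖f.sum fun _ x => x‖ ^ 2 = ∑ μ ∈ f.support, ‖f μ‖ ^ 2 := by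
    rw [← real_inner_self_eq_norm_sq, Finsupp.sum]
    simpa using hsum fun _ => 1
  simp only [mem_ofPred_eq]
  rw [h1, Finsupp.sum, map_sum]
  simp only [hTf]
  rw [hsum, Finset.mul_sum]
  refine Finset.sum_le_sum fun μ hμ => ?_
  gcongr
  exact h μ (hasEigenvalue_of_hasEigenvector ⟨hf μ, Finsupp.mem_support_iff.1 hμ⟩)

/-- The complement of the eigenvectors above `c` is invariant, and the restriction of `T` has no
eigenvalue above `c`: its eigenvector would be orthogonal to itself. -/
theorem inner_apply_self_le_of_mem_orthogonal (hT : IsCompactOperator T)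
    (hT' : (T : H →ₗ[ℝ] H).IsSymmetric) {c : ℝ} {u : H}
    (hu : u ∈ (Submodule.span ℝ {e | ∃ μ > c, T e = μ • e})ᗮ) :
    ⟪T u, u⟫ ≤ c * ‖u‖ ^ 2 := by
  set S : Set H := {e | ∃ μ > c, T e = μ • e}
  have hinv : ∀ v ∈ (Submodule.span ℝ S)ᗮ, (T : H →ₗ[ℝ] H) v ∈ (Submodule.span ℝ S)ᗮ := by
    intro v hv
    rw [Submodule.mem_orthogonal] at hv ⊢
    intro w hw
    have hTw : T w ∈ Submodule.span ℝ S := by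
      induction hw using Submodule.span_induction with
      | mem x hx =>
        obtain ⟨μ, hμ, hx'⟩ := hx
        rw [hx']
        exact Submodule.smul_mem _ _ (Submodule.subset_span ⟨μ, hμ, hx'⟩)
      | zero => simp
      | add x y _ _ hx hy => rw [map_add]; exact add_mem hx hy
      | smul a x _ hx => rw [map_smul]; exact Submodule.smul_mem _ _ hx
    rw [← hT' w v]
    exact hv _ hTw
  let R : (Submodule.span ℝ S)ᗮ →L[ℝ] (Submodule.span ℝ S)ᗮ := T.restrict hinv
  have hR : IsCompactOperator R := hT.restrict' hinv
  have hR' : (R : _ →ₗ[ℝ] (Submodule.span ℝ S)ᗮ).IsSymmetric := hT'.restrict_invariant hinv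
  refine inner_apply_self_le_of_forall_eigenvalue_le hR hR' (c := c) (fun μ hμ => ?_) ⟨u, hu⟩
  by_contra! hlt
  obtain ⟨v, hv, hv0⟩ := hμ.exists_hasEigenvector
  have hTv : T v = μ • (v : H) := congrArg Subtype.val (Module.End.mem_eigenspace_iff.1 hv)
  have hvS : (v : H) ∈ Submodule.span ℝ S := Submodule.subset_span ⟨μ, hlt, hTv⟩
  have := Submodule.inner_right_of_mem_orthogonal hvS v.2
  exact hv0 (Subtype.ext (inner_self_eq_zero.1 this))

/-- If the quadratic form of `T` exceeds `c` times the squared norm on the span of `n`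
vectors, then `T` has at least `n` linearly independent eigenvectors with eigenvalues greater than `c`. -/
theorem exists_linearIndependent_eigenvectors (hT : IsCompactOperator T)
    (hT' : (T : H →ₗ[ℝ] H).IsSymmetric) {c : ℝ} {ι : Type*} [Fintype ι] (u : ι → H)
    (hu : ∀ a : ι → ℝ, a ≠ 0 → c * ‖∑ i, a i • u i‖ ^ 2 < ⟪T (∑ i, a i • u i), ∑ i, a i • u i⟫) :
    ∃ b : Finset H, b.card = Fintype.card ι ∧ LinearIndependent ℝ (Subtype.val : b → H) ∧
      ∀ e ∈ b, ∃ μ > c, T e = μ • e := by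
  obtain ⟨b, hbS, hspan, hli⟩ := exists_linearIndependent ℝ {e | ∃ μ > c, T e = μ • e}
  suffices h : ∃ b' : Finset H, (b' : Set H) ⊆ b ∧ b'.card = Fintype.card ι by
    obtain ⟨b', h1, h2⟩ := h
    exact ⟨b', h2, hli.comp (Set.inclusion h1) (Set.inclusion_injective h1), fun e he => hbS (h1 he)⟩
  by_cases hfin : b.Finite
  · have hcard : Fintype.card ι ≤ hfin.toFinset.card := by
      by_contra! hlt
      -- With too few eigenvectors, a dimension count yields a nontrivial combination of the `u i`
      -- orthogonal to all of them, where the form is at most `c` times the squared norm.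
      let Φ : (ι → ℝ) →ₗ[ℝ] (hfin.toFinset → ℝ) := LinearMap.pi fun e =>
        (innerSL ℝ (e : H) : H →ₗ[ℝ] ℝ) ∘ₗ Fintype.linearCombination ℝ u
      have hni : ¬ Function.Injective Φ := fun hinj => by
        have := LinearMap.finrank_le_finrank_of_injective hinj
        simp only [Module.finrank_fintype_fun_eq_card, Fintype.card_coe] at this
        omega
      obtain ⟨a, ha, ha0⟩ : ∃ a, Φ a = 0 ∧ a ≠ 0 := by
        by_contra! h
        exact hni ((injective_iff_map_eq_zero Φ).2 h)
      have horth : ∑ i, a i • u i ∈ (Submodule.span ℝ {e | ∃ μ > c, T e = μ • e})ᗮ := by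
        rw [← hspan, Submodule.mem_orthogonal]
        intro w hw
        induction hw using Submodule.span_induction with
        | mem x hx =>
          have := congrFun ha ⟨x, hfin.mem_toFinset.2 hx⟩
          simpa [Φ, Fintype.linearCombination_apply] using this
        | zero => simp
        | add x y _ _ hx hy => rw [inner_add_left, hx, hy, add_zero]
        | smul r x _ hx => rw [real_inner_smul_left, hx, mul_zero]
      exact absurd (inner_apply_self_le_of_mem_orthogonal hT hT' horth) (not_le.2 (hu a ha0))
    obtain ⟨b', h1, h2⟩ := Finset.exists_subset_card_eq hcard
    exact ⟨b', fun x hx => hfin.mem_toFinset.1 (h1 hx), h2⟩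
  · exact Set.Infinite.exists_subset_card_eq hfin _

end Compact

/-! ### The Green operator -/

section Green

variable (ν : Measure ℝ)

/-- The rank one operator `u ↦ ⟪k_y, u⟫ k_y`. -/
noncomputable def rankOneKern (y : ℝ) : L2 →L[ℝ] L2 :=
  (innerSL ℝ (kern y)).smulRight (kern y)

/-- The operator on `L²([0,1])` representing the form `∫ f g dν`. -/
noncomputable def green : L2 →L[ℝ] L2 := ∫ y, rankOneKern y ∂ν

theorem rankOneKern_apply (y : ℝ) (u : L2) : rankOneKern y u = ⟪kern y, u⟫ • kern y := rfl

theorem continuous_rankOneKern : Continuous rankOneKern := by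
  have h : Continuous fun p : L2 × L2 => (innerSL ℝ p.1).smulRight p.2 := by
    have := (ContinuousLinearMap.smulRightL ℝ L2 L2).continuous₂
    exact this.comp (((innerSL ℝ (E := L2)).continuous.comp continuous_fst).prodMk continuous_snd)
  exact h.comp (continuous_kern.prodMk continuous_kern)

theorem isCompactOperator_rankOneKern (y : ℝ) : IsCompactOperator (rankOneKern y) := by
  have : rankOneKern y = (ContinuousLinearMap.toSpanSingleton ℝ (kern y)) ∘L innerSL ℝ (kern y) := by
    ext1 u; simp [rankOneKern_apply]
  rw [this]
  have h : IsCompactOperator (innerSL ℝ (kern y)) :=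
    isCompactOperator_of_locallyCompactSpace_dom _
  exact h.clm_comp (ContinuousLinearMap.toSpanSingleton ℝ (kern y))

variable {ν}

theorem ae_mem_Icc (hν : ν (Ioo (0 : ℝ) 1)ᶜ = 0) : ∀ᵐ y ∂ν, y ∈ Icc (0 : ℝ) 1 := by
  filter_upwards [measure_eq_zero_iff_ae_notMem.1 hν] with y hy
  exact Ioo_subset_Icc_self (not_not.1 hy)

variable [IsFiniteMeasure ν]

theorem integrable_rankOneKern (hν : ν (Ioo (0 : ℝ) 1)ᶜ = 0) : Integrable rankOneKern ν := by
  refine Integrable.of_bound continuous_rankOneKern.aestronglyMeasurable 1 ?_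
  filter_upwards [ae_mem_Icc hν] with y hy
  have := norm_kern_le hy
  rw [rankOneKern, ContinuousLinearMap.norm_smulRight_apply, innerSL_apply_norm]
  exact mul_le_one₀ this (norm_nonneg _) this

/-- The compact operators form a closed subspace, so the average of the rank one operators stays in
it. -/
theorem isCompactOperator_green (hν : ν (Ioo (0 : ℝ) 1)ᶜ = 0) : IsCompactOperator (green ν) := by
  rcases eq_or_ne ν 0 with rfl | h0
  · rw [green, integral_zero_measure]; exact isCompactOperator_zero
  have := NeZero.mk h0
  let S : Submodule ℝ (L2 →L[ℝ] L2) := compactOperator (RingHom.id ℝ) L2 L2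
  have hmem : ⨍ y, rankOneKern y ∂ν ∈ S :=
    S.convex.average_mem isClosed_setOfPred_isCompactOperator
      (Eventually.of_forall isCompactOperator_rankOneKern) (integrable_rankOneKern hν)
  have : green ν = ν.real univ • ⨍ y, rankOneKern y ∂ν := (measure_smul_average ν _).symm
  rw [this]
  exact S.smul_mem _ hmem

theorem inner_green (hν : ν (Ioo (0 : ℝ) 1)ᶜ = 0) (u v : L2) :
    ⟪green ν u, v⟫ = ∫ y, ⟪kern y, u⟫ * ⟪kern y, v⟫ ∂ν := by
  have hi := integrable_rankOneKern hν
  rw [green, ContinuousLinearMap.integral_apply hi, real_inner_comm, ← integral_inner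
    (hi.apply_continuousLinearMap u)]
  simp [rankOneKern_apply, real_inner_smul_right, real_inner_comm]

theorem isSymmetric_green (hν : ν (Ioo (0 : ℝ) 1)ᶜ = 0) :
    (green ν : L2 →ₗ[ℝ] L2).IsSymmetric := by
  intro u v
  change ⟪green ν u, v⟫ = ⟪u, green ν v⟫
  rw [real_inner_comm _ u, inner_green hν, inner_green hν]
  simp [mul_comm]

theorem integral_primitive_mul (hν : ν (Ioo (0 : ℝ) 1)ᶜ = 0) (u v : L2) :
    ∫ y, primitive u y * primitive v y ∂ν = ⟪green ν u, v⟫ := by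
  rw [inner_green hν]
  refine integral_congr_ae ?_
  filter_upwards [ae_mem_Icc hν] with y hy
  rw [primitive_apply hy, primitive_apply hy]

theorem integrable_inner_kern_mul (hν : ν (Ioo (0 : ℝ) 1)ᶜ = 0) (u v : L2) :
    Integrable (fun y => ⟪kern y, u⟫ * ⟪kern y, v⟫) ν := by
  refine Integrable.of_bound (C := ‖u‖ * ‖v‖) (by
    have := continuous_kern
    exact Continuous.aestronglyMeasurable (by fun_prop)) ?_
  filter_upwards [ae_mem_Icc hν] with y hy
  have h1 := norm_kern_le hy
  rw [norm_mul]
  have h2 : ∀ w : L2, ‖⟪kern y, w⟫‖ ≤ ‖w‖ := fun w =>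
    (norm_inner_le_norm _ _).trans (mul_le_of_le_one_left (norm_nonneg _) h1)
  gcongr <;> exact h2 _

theorem inner_one_green (hν : ν (Ioo (0 : ℝ) 1)ᶜ = 0) (u : L2) : ⟪ind 1, green ν u⟫ = 0 := by
  rw [real_inner_comm, inner_green hν]
  refine integral_eq_zero_of_ae ?_
  filter_upwards [ae_mem_Icc hν] with y hy
  rw [real_inner_comm (ind 1), inner_one_kern hy]
  simp

theorem integrable_inner_kern (hν : ν (Ioo (0 : ℝ) 1)ᶜ = 0) (u : L2) :
    Integrable (fun y => ⟪kern y, u⟫) ν := by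
  refine Integrable.of_bound (C := ‖u‖) (by
    have := continuous_kern
    exact Continuous.aestronglyMeasurable (by fun_prop)) ?_
  filter_upwards [ae_mem_Icc hν] with y hy
  exact (norm_inner_le_norm _ _).trans (mul_le_of_le_one_left (norm_nonneg _) (norm_kern_le hy))

/-- The value at `x` is `∫ (min y x - y x) ⟪k_y, u⟫ dν(y)`. While `x` stays in one component, each
`y` in the support keeps its side, so the kernel is affine in `x`. -/
theorem affineOffSupport_primitive_green (hν : ν (Ioo (0 : ℝ) 1)ᶜ = 0) (u : L2) :
    AffineOffSupport ν (primitive (green ν u)) := by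
  intro x₀ hx₀
  set C := connectedComponentIn (Icc (0 : ℝ) 1 \ ν.support) x₀
  have hCsub : C ⊆ Icc (0 : ℝ) 1 \ ν.support := connectedComponentIn_subset _ _
  have hC : C.OrdConnected := isPreconnected_connectedComponentIn.ordConnected
  have hx₀C : x₀ ∈ C := mem_connectedComponentIn hx₀
  set φ : ℝ → ℝ := fun y => ⟪kern y, u⟫
  have hφ : Integrable φ ν := integrable_inner_kern hν u
  have hyφ : Integrable (fun y => y * φ y) ν := by
    refine hφ.mono (continuous_id.aestronglyMeasurable.mul hφ.1) ?_
    filter_upwards [ae_mem_Icc hν] with y hy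
    rw [norm_mul]
    refine mul_le_of_le_one_left (norm_nonneg _) ?_
    rw [Real.norm_eq_abs, abs_le]; constructor <;> linarith [hy.1, hy.2]
  have hL : MeasurableSet (Iio x₀) := measurableSet_Iio
  -- For `y` in the support, being left of `x₀` means being left of the whole component, so `min y
  -- x` is `y` there and `x` otherwise.
  refine ⟨(∫ y, (Iio x₀)ᶜ.indicator φ y ∂ν) - ∫ y, y * φ y ∂ν,
    ∫ y, (Iio x₀).indicator (fun y => y * φ y) y ∂ν, fun x hx => ?_⟩
  have hx01 := (hCsub hx).1
  have hsub : Integrable (fun y => (Iio x₀)ᶜ.indicator φ y * x - y * φ y * x) ν :=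
    ((hφ.indicator hL.compl).mul_const x).sub (hyφ.mul_const x)
  rw [primitive_apply hx01, real_inner_comm, inner_green hν, sub_mul, ← integral_mul_const,
    ← integral_mul_const, ← integral_sub ((hφ.indicator hL.compl).mul_const x) (hyφ.mul_const x),
    ← integral_add hsub (hyφ.indicator hL)]
  refine integral_congr_ae ?_
  filter_upwards [ae_mem_Icc hν,
    measure_eq_zero_iff_ae_notMem.1 (Measure.measure_compl_support (μ := ν))] with y hy hys
  rw [notMem_compl_iff] at hys
  simp only [inner_kern_kern hy hx01]
  have hyC : y ∉ C := fun h => (hCsub h).2 hys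
  by_cases hlt : y < x₀
  · have hyx : y ≤ x := by
      by_contra! h
      exact hyC (hC.out hx hx₀C ⟨h.le, hlt.le⟩)
    simp [hlt, min_eq_left hyx, φ]
    ring
  · have hyx : x ≤ y := by
      by_contra! h
      exact hyC (hC.out hx₀C hx ⟨not_lt.1 hlt, h.le⟩)
    simp [hlt, min_eq_right hyx, φ, not_lt.1 hlt]
    ring

end Green

/-! ### The upper bound for the eigenvalue counting function -/

theorem AffineOffSupport.add {ν : Measure ℝ} {f g : ℝ → ℝ} (hf : AffineOffSupport ν f)
    (hg : AffineOffSupport ν g) : AffineOffSupport ν (f + g) := by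
  intro x hx
  obtain ⟨m, c, h⟩ := hf x hx
  obtain ⟨m', c', h'⟩ := hg x hx
  exact ⟨m + m', c + c', fun y hy => by rw [Pi.add_apply, h y hy, h' y hy]; ring⟩

theorem AffineOffSupport.smul {ν : Measure ℝ} {f : ℝ → ℝ} (hf : AffineOffSupport ν f) (a : ℝ) :
    AffineOffSupport ν (a • f) := by
  intro x hx
  obtain ⟨m, c, h⟩ := hf x hx
  exact ⟨a * m, a * c, fun y hy => by rw [Pi.smul_apply, h y hy, smul_eq_mul]; ring⟩

theorem affineOffSupport_zero (ν : Measure ℝ) : AffineOffSupport ν 0 :=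
  fun _ _ => ⟨0, 0, fun _ _ => by simp⟩

/-- The derivatives of the elements of the eigenspace for `l`. -/
noncomputable def eigenDerivs (ν : Measure ℝ) (l : ℝ) : Submodule ℝ L2 where
  carrier := {u | ⟪ind 1, u⟫ = 0 ∧ AffineOffSupport ν (primitive u) ∧
    ∀ v, ⟪ind 1, v⟫ = 0 → AffineOffSupport ν (primitive v) → ⟪u, v⟫ = l * ⟪green ν u, v⟫}
  add_mem' := by
    rintro u w ⟨h1, h2, h3⟩ ⟨h1', h2', h3'⟩
    refine ⟨by rw [inner_add_right, h1, h1', add_zero], by rw [map_add]; exact h2.add h2',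
      fun v hv hv' => ?_⟩
    rw [inner_add_left, h3 v hv hv', h3' v hv hv', map_add, inner_add_left, mul_add]
  zero_mem' := ⟨by simp, by rw [map_zero]; exact affineOffSupport_zero ν, by simp⟩
  smul_mem' := by
    rintro a u ⟨h1, h2, h3⟩
    refine ⟨by rw [real_inner_smul_right, h1, mul_zero], by rw [map_smul]; exact h2.smul a,
      fun v hv hv' => ?_⟩
    rw [real_inner_smul_left, h3 v hv hv', map_smul, real_inner_smul_left]
    ring

theorem multiplicity_le {ν : Measure ℝ} [IsFiniteMeasure ν] (hν : ν (Ioo (0 : ℝ) 1)ᶜ = 0) (l : ℝ) :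
    multiplicity ν l ≤ Cardinal.toENat (Module.rank ℝ (eigenDerivs ν l)) := by
  refine Cardinal.toENat.monotone' ?_
  have hsub : Submodule.span ℝ {f | IsEigenfunction ν l f} ≤ (eigenDerivs ν l).map primitive := by
    rw [Submodule.span_le]
    rintro f ⟨⟨hf, hfa⟩, -, hfe⟩
    obtain ⟨u, hu, rfl⟩ := exists_primitive_eq hf
    refine ⟨u, ⟨hu, hfa, fun v hv hva => ?_⟩, rfl⟩
    rw [← energy_primitive hu hv, hfe _ ⟨primitive_mem_H10 hv, hva⟩, integral_primitive_mul hν]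
  exact (Submodule.rank_mono hsub).trans (rank_map_le _ _)

/-- A finite measure `ρ` admits a partition of `[0,1]` into `m + 1` intervals whose interiors
have `ρ`-measure at most `1/m`-th of the total mass. -/
theorem exists_quantile_partition (ρ : Measure ℝ) [IsFiniteMeasure ρ] (hρ : 0 < ρ.real univ)
    {m : ℕ} (hm : 0 < m) :
    ∃ t : ℕ → ℝ, Monotone t ∧ (∀ j, t j ∈ Icc (0 : ℝ) 1) ∧ t 0 = 0 ∧ t (m + 1) = 1 ∧
      ∀ j, ρ.real (Ioo (t j) (t (j + 1))) ≤ ρ.real univ / m := by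
  have hm' : (0 : ℝ) < m := by exact_mod_cast hm
  set d := ρ.real univ / m
  have hd : 0 < d := by positivity
  -- The infima are the `j d`-quantiles of `ρ`; the point `1` is adjoined to keep the sets nonempty,
  -- and it is all that remains for `j = m + 1`.
  let S : ℕ → Set ℝ := fun j => {t | t ∈ Icc (0 : ℝ) 1 ∧ (t = 1 ∨ j * d ≤ ρ.real (Iic t))}
  have hS1 : ∀ j, (1 : ℝ) ∈ S j := fun j => ⟨by simp, Or.inl rfl⟩
  have hbdd : ∀ j, BddBelow (S j) := fun j => ⟨0, fun t ht => ht.1.1⟩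
  have hmem : ∀ j, sInf (S j) ∈ Icc (0 : ℝ) 1 := fun j =>
    ⟨le_csInf ⟨1, hS1 j⟩ fun t ht => ht.1.1, csInf_le (hbdd j) (hS1 j)⟩
  refine ⟨fun j => sInf (S j), ?_, hmem, ?_, ?_, ?_⟩
  · intro i j hij
    refine csInf_le_csInf (hbdd i) ⟨1, hS1 j⟩ fun t ht => ⟨ht.1, ht.2.imp_right fun h => ?_⟩
    refine le_trans ?_ h
    gcongr
  · refine le_antisymm (csInf_le (hbdd 0) ⟨by simp, Or.inr ?_⟩) (hmem 0).1
    simp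
  · have : S (m + 1) ⊆ {1} := by
      rintro t ⟨-, h | h⟩
      · exact h
      · have h1 : ρ.real (Iic t) ≤ ρ.real univ := measureReal_mono (subset_univ _)
        have h2 : ρ.real univ = m * d := by simp only [d]; field_simp
        push_cast at h
        linarith
    change sInf (S (m + 1)) = 1
    rw [this.antisymm (singleton_subset_iff.2 (hS1 _)), csInf_singleton]
  · intro j
    have key : ∀ s s', sInf (S j) < s → s < s' → s' < sInf (S (j + 1)) →
        ρ.real (Ioc s s') ≤ d := by
      intro s s' hs hss' hs'
      obtain ⟨r, hr, hrs⟩ := exists_lt_of_csInf_lt ⟨1, hS1 j⟩ hs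
      have hle := (hmem (j + 1)).2
      have h1 : j * d ≤ ρ.real (Iic s) := by
        rcases hr.2 with h | h
        · linarith
        · exact h.trans (measureReal_mono (Iic_subset_Iic.2 hrs.le))
      have h2 : ρ.real (Iic s') < (j + 1) * d := by
        by_contra! h
        refine (csInf_le (hbdd (j + 1)) ⟨⟨?_, by linarith⟩, Or.inr ?_⟩).not_gt hs'
        · linarith [(hmem j).1]
        · push_cast; exact h
      have h3 : ρ.real (Iic s') = ρ.real (Iic s) + ρ.real (Ioc s s') := by
        rw [← measureReal_union (Iic_disjoint_Ioc le_rfl) measurableSet_Ioc,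
          Iic_union_Ioc_eq_Iic hss'.le]
      linarith
    -- Atoms may sit at the cut points, so only intervals strictly inside are controlled by `key`;
    -- inner regularity by compact sets extends the bound to the open interval.
    by_contra! hlt
    have hlt' : ENNReal.ofReal d < ρ (Ioo (sInf (S j)) (sInf (S (j + 1)))) :=
      (ENNReal.ofReal_lt_iff_lt_toReal hd.le (measure_ne_top _ _)).2 hlt
    obtain ⟨K, hKsub, hK, hdK⟩ := isOpen_Ioo.exists_lt_isCompact hlt'
    have hne : K.Nonempty := by
      rw [nonempty_iff_ne_empty]; rintro rfl; simp at hdK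
    obtain ⟨s, hs1, hs2⟩ := exists_between (hKsub (hK.sInf_mem hne)).1
    have hle : sInf K ≤ sSup K := csInf_le hK.bddBelow (hK.sSup_mem hne)
    have h1 := key s (sSup K) hs1 (hs2.trans_le hle) (hKsub (hK.sSup_mem hne)).2
    have h2 : ρ K ≤ ρ (Ioc s (sSup K)) := measure_mono fun x hx =>
      ⟨hs2.trans_le (csInf_le hK.bddBelow hx), le_csSup hK.bddAbove hx⟩
    refine (hdK.trans_le h2).not_ge ?_
    rw [← ofReal_measureReal]
    exact ENNReal.ofReal_le_ofReal h1

/-! ### Poincaré inequality on a partition -/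

theorem integrableOn_sq (u : L2) : IntegrableOn (fun t => u t ^ 2) (Icc 0 1) :=
  (Lp.memLp u).integrable_sq

theorem integrableOn_coeFn (u : L2) : IntegrableOn u (Icc 0 1) :=
  (Lp.memLp u).integrable (by norm_num)

/-- Cauchy–Schwarz, obtained from the nonnegativity of the variance of `u` on the interval. -/
theorem sq_setIntegral_le {u : ℝ → ℝ} {a b : ℝ} (hab : a ≤ b) (hu : IntegrableOn u (Ioc a b))
    (hu2 : IntegrableOn (fun t => u t ^ 2) (Ioc a b)) :
    (∫ t in Ioc a b, u t) ^ 2 ≤ (b - a) * ∫ t in Ioc a b, u t ^ 2 := by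
  rcases hab.eq_or_lt with rfl | hlt
  · simp
  set I := ∫ t in Ioc a b, u t
  have h0 : 0 ≤ ∫ t in Ioc a b, (u t - I / (b - a)) ^ 2 := integral_nonneg fun t => sq_nonneg _
  have h1 : ∫ t in Ioc a b, (u t - I / (b - a)) ^ 2
      = (∫ t in Ioc a b, u t ^ 2) - 2 * (I / (b - a)) * I + (I / (b - a)) ^ 2 * (b - a) := by
    have e : ∀ t, (u t - I / (b - a)) ^ 2
        = u t ^ 2 - 2 * (I / (b - a)) * u t + (I / (b - a)) ^ 2 := fun t => by ring
    simp only [e]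
    have hint : IntegrableOn (fun t => u t ^ 2 - 2 * (I / (b - a)) * u t) (Ioc a b) :=
      hu2.sub (hu.const_mul _)
    rw [integral_add hint (integrable_const _),
      integral_sub hu2 (hu.const_mul _), integral_const_mul, setIntegral_const,
      Real.volume_real_Ioc_of_le hab, smul_eq_mul]
    ring
  rw [h1] at h0
  have hpos : 0 < b - a := sub_pos.2 hlt
  have h2 : (∫ t in Ioc a b, u t ^ 2) - 2 * (I / (b - a)) * I + (I / (b - a)) ^ 2 * (b - a)
      = (∫ t in Ioc a b, u t ^ 2) - I ^ 2 / (b - a) := by field_simp; ring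
  rw [h2, sub_nonneg, div_le_iff₀ hpos] at h0
  linarith

theorem sq_inner_kern_le {u : L2} (hu : ⟪ind 1, u⟫ = 0) {a b x : ℝ} (ha : 0 ≤ a) (hb : b ≤ 1)
    (hx : x ∈ Ioo a b) (h : ⟪kern a, u⟫ = 0) :
    ⟪kern x, u⟫ ^ 2 ≤ (b - a) * ∫ t in Ioo a b, u t ^ 2 := by
  have hx1 : x ≤ 1 := hx.2.le.trans hb
  have hsub : Ioc a x ⊆ Icc 0 1 := fun t ht => ⟨ha.trans ht.1.le, ht.2.trans hx1⟩
  have hsub' : Ioo a b ⊆ Icc 0 1 := fun t ht => ⟨ha.trans ht.1.le, ht.2.le.trans hb⟩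
  have e : ⟪kern x, u⟫ = ∫ t in Ioc a x, u t := by
    have h1 : ⟪kern x, u⟫ = ⟪kern x, u⟫ - ⟪kern a, u⟫ := by rw [h, sub_zero]
    rw [h1, kern, kern, inner_sub_left, inner_sub_left, real_inner_smul_left, real_inner_smul_left,
      hu, inner_ind hx1, inner_ind (hx.1.le.trans hx1), ← Icc_union_Ioc_eq_Icc ha hx.1.le,
      setIntegral_union (by
        rw [Set.disjoint_left]; intro t ht ht'; exact ht'.1.not_ge ht.2) measurableSet_Ioc
        ((integrableOn_coeFn u).mono_set (Icc_subset_Icc_right (hx.1.le.trans hx1)))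
        ((integrableOn_coeFn u).mono_set hsub)]
    ring
  rw [e]
  refine (sq_setIntegral_le hx.1.le ((integrableOn_coeFn u).mono_set hsub)
    ((integrableOn_sq u).mono_set hsub)).trans ?_
  have h3 : ∫ t in Ioc a x, u t ^ 2 ≤ ∫ t in Ioo a b, u t ^ 2 :=
    setIntegral_mono_set ((integrableOn_sq u).mono_set hsub')
      (Eventually.of_forall fun t => sq_nonneg _)
      (LE.le.eventuallyLE fun t ht => ⟨ht.1, ht.2.trans_lt hx.2⟩)
  have h4 : 0 ≤ ∫ t in Ioc a x, u t ^ 2 := integral_nonneg fun t => sq_nonneg _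
  have := hx.2
  have := hx.1
  gcongr
  linarith

theorem integral_sq_eq (u : L2) : ∫ t in Icc 0 1, u t ^ 2 = ‖u‖ ^ 2 := by
  rw [← real_inner_self_eq_norm_sq, MeasureTheory.L2.inner_def]
  simp [sq]

/-- Poincaré inequality for functions vanishing at the points of a fine partition. -/
theorem inner_green_self_le {ν : Measure ℝ} [IsFiniteMeasure ν] (hν : ν (Ioo (0 : ℝ) 1)ᶜ = 0)
    {t : ℕ → ℝ} {k : ℕ} {d : ℝ} (hd : 0 ≤ d) (ht : Monotone t) (ht01 : ∀ j, t j ∈ Icc (0 : ℝ) 1)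
    (ht0 : t 0 = 0) (htk : t k = 1) (hlen : ∀ j, t (j + 1) - t j ≤ d)
    (hmass : ∀ j, ν.real (Ioo (t j) (t (j + 1))) ≤ d) {u : L2} (hu : ⟪ind 1, u⟫ = 0)
    (hz : ∀ j ≤ k, ⟪kern (t j), u⟫ = 0) :
    ⟪green ν u, u⟫ ≤ d ^ 2 * ‖u‖ ^ 2 := by
  set Q : ℕ → ℝ := fun j => ∫ s in Ioo (t j) (t (j + 1)), u s ^ 2
  have hQ : ∀ j, 0 ≤ Q j := fun j => integral_nonneg fun s => sq_nonneg _
  have hpt : ∀ y ∈ Ioo (0 : ℝ) 1, ⟪kern y, u⟫ * ⟪kern y, u⟫ ≤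
      ∑ j ∈ Finset.range k, (Ioo (t j) (t (j + 1))).indicator (fun _ => d * Q j) y := by
    intro y hy
    have hnn : ∀ j ∈ Finset.range k,
        0 ≤ (Ioo (t j) (t (j + 1))).indicator (fun _ => d * Q j) y := fun j _ =>
      indicator_nonneg (fun _ _ => mul_nonneg hd (hQ j)) _
    have hex : ∀ i, y < t i → ∃ j < i, t j ≤ y ∧ y < t (j + 1) := by
      intro i
      induction i with
      | zero => intro h; rw [ht0] at h; exact absurd hy.1 h.not_gt
      | succ i ih =>
        intro h
        rcases le_or_gt (t i) y with h' | h'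
        · exact ⟨i, by omega, h', h⟩
        · obtain ⟨j, hj, hj'⟩ := ih h'
          exact ⟨j, by omega, hj'⟩
    obtain ⟨j, hj, hj1, hj2⟩ := hex k (by rw [htk]; exact hy.2)
    -- At a cut point the function vanishes, so atoms of `ν` there are harmless. Inside a cell one
    -- factor `d` comes from the length; integrating against `ν` supplies the second.
    rcases hj1.eq_or_lt with h | h
    · rw [← h, hz j hj.le, mul_zero]; rw [← h] at hnn; exact Finset.sum_nonneg hnn
    · refine le_trans ?_ (Finset.single_le_sum hnn (Finset.mem_range.2 hj))
      rw [indicator_of_mem (show y ∈ Ioo (t j) (t (j + 1)) from ⟨h, hj2⟩), ← sq]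
      refine (sq_inner_kern_le hu (ht01 j).1 (ht01 (j + 1)).2 ⟨h, hj2⟩ (hz j hj.le)).trans ?_
      exact mul_le_mul_of_nonneg_right (hlen j) (hQ j)
  have hint : ∀ j ∈ Finset.range k,
      Integrable ((Ioo (t j) (t (j + 1))).indicator fun _ : ℝ => d * Q j) ν := fun j _ =>
    (integrable_const _).indicator measurableSet_Ioo
  rw [inner_green hν]
  calc ∫ y, ⟪kern y, u⟫ * ⟪kern y, u⟫ ∂ν
      ≤ ∫ y, ∑ j ∈ Finset.range k, (Ioo (t j) (t (j + 1))).indicator (fun _ => d * Q j) y ∂ν := by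
        refine integral_mono_ae (integrable_inner_kern_mul hν u u) (integrable_finsetSum _ hint) ?_
        filter_upwards [measure_eq_zero_iff_ae_notMem.1 hν] with y hy
        exact hpt y (not_not.1 hy)
    _ = ∑ j ∈ Finset.range k, ν.real (Ioo (t j) (t (j + 1))) * (d * Q j) := by
        rw [integral_finsetSum _ hint]
        refine Finset.sum_congr rfl fun j _ => ?_
        rw [integral_indicator_const _ measurableSet_Ioo, smul_eq_mul]
    _ ≤ ∑ j ∈ Finset.range k, d * (d * Q j) := by
        refine Finset.sum_le_sum fun j _ => ?_
        exact mul_le_mul_of_nonneg_right (hmass j) (mul_nonneg hd (hQ j))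
    _ = d ^ 2 * ∑ j ∈ Finset.range k, Q j := by
        rw [Finset.mul_sum]; exact Finset.sum_congr rfl fun j _ => by ring
    _ ≤ d ^ 2 * ‖u‖ ^ 2 := by
        have hsub : ∀ j, Ioo (t j) (t (j + 1)) ⊆ Icc 0 1 := fun j s hs =>
          ⟨(ht01 j).1.trans hs.1.le, hs.2.le.trans (ht01 (j + 1)).2⟩
        have hdisj : ((Finset.range k : Finset ℕ) : Set ℕ).Pairwise
            (Function.onFun Disjoint fun j => Ioo (t j) (t (j + 1))) :=
          fun i _ j _ hij => ht.pairwise_disjoint_on_Ioo_succ hij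
        gcongr
        rw [← integral_biUnion_finset _ (fun j _ => measurableSet_Ioo) hdisj
          (fun j _ => (integrableOn_sq u).mono_set (hsub j)), ← integral_sq_eq]
        exact setIntegral_mono_set (integrableOn_sq u) (Eventually.of_forall fun t => sq_nonneg _)
          (LE.le.eventuallyLE (iUnion₂_subset fun j _ => hsub j))

/-- Evaluation at the `m + 2` cut points is injective on the sum of the eigenspaces: on its kernel
`‖u‖² ≤ x ⟪G u, u⟫ ≤ x d² ‖u‖²` with `G = green ν` and `x d² < 1`. -/
theorem sum_multiplicity_le {ν : Measure ℝ} [IsFiniteMeasure ν] (hν : ν (Ioo (0 : ℝ) 1)ᶜ = 0)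
    {m : ℕ} (hm : 0 < m) {x : ℝ} (hx0 : 0 ≤ x) (hx : x * ((ν.real univ + 1) / m) ^ 2 < 1)
    {s : Finset ℝ} (hs : ∀ l ∈ s, l ≤ x) :
    ∑ l ∈ s, multiplicity ν l ≤ ((m + 2 : ℕ) : ℕ∞) := by
  -- Adding Lebesgue measure lets one quantile partition control masses and lengths simultaneously.
  set ρ : Measure ℝ := ν + volume.restrict (Ioo 0 1) with hρdef
  have hρ : ρ.real univ = ν.real univ + 1 := by
    rw [hρdef, measureReal_add_apply]; simp
  obtain ⟨t, ht, ht01, ht0, ht1, hmass⟩ := exists_quantile_partition ρ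
    (by rw [hρ]; positivity) hm
  rw [hρ] at hmass
  set d := (ν.real univ + 1) / m
  have hd : 0 ≤ d := by positivity
  have hmass1 : ∀ j, ν.real (Ioo (t j) (t (j + 1))) ≤ d := fun j => by
    refine le_trans ?_ (hmass j)
    rw [hρdef, measureReal_add_apply]
    exact le_add_of_nonneg_right measureReal_nonneg
  have hlen : ∀ j, t (j + 1) - t j ≤ d := fun j => by
    refine le_trans ?_ (hmass j)
    rw [hρdef, measureReal_add_apply, measureReal_restrict_apply measurableSet_Ioo,
      inter_eq_left.2 (Ioo_subset_Ioo (ht01 j).1 (ht01 (j + 1)).2),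
      Real.volume_real_Ioo_of_le (ht (Nat.le_succ j))]
    exact le_add_of_nonneg_left measureReal_nonneg
  let total : (∀ l : s, eigenDerivs ν l) →ₗ[ℝ] L2 :=
    ∑ l : s, (eigenDerivs ν l).subtype ∘ₗ LinearMap.proj l
  have htotal : ∀ w, total w = ∑ l : s, (w l : L2) := fun w => by simp [total]
  let Φ : (∀ l : s, eigenDerivs ν l) →ₗ[ℝ] (Fin (m + 2) → ℝ) :=
    LinearMap.pi fun j => (innerSL ℝ (kern (t j)) : L2 →ₗ[ℝ] ℝ) ∘ₗ total
  have hinj : Function.Injective Φ := by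
    rw [injective_iff_map_eq_zero]
    intro w hw
    set u : L2 := total w with hudef
    have hz : ∀ j ≤ m + 1, ⟪kern (t j), u⟫ = 0 := fun j hj =>
      congrFun hw ⟨j, by omega⟩
    have hu : ⟪ind 1, u⟫ = 0 := by
      rw [hudef, htotal, inner_sum]
      exact Finset.sum_eq_zero fun l _ => (w l).2.1
    have hgu := inner_green_self_le hν hd ht ht01 ht0 ht1 hlen hmass1 hu hz
    have hww : ∀ l l' : s, ⟪(w l : L2), (w l' : L2)⟫ = l * ⟪green ν (w l), (w l' : L2)⟫ :=
      fun l l' => (w l).2.2.2 _ (w l').2.1 (w l').2.2.1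
    have horth : ∀ l l' : s, l ≠ l' → ⟪green ν (w l), (w l' : L2)⟫ = 0 := by
      intro l l' hne
      have h1 := hww l l'
      have h2 := hww l' l
      have h3 : ⟪green ν (w l'), (w l : L2)⟫ = ⟪green ν (w l), (w l' : L2)⟫ := by
        rw [real_inner_comm]; exact (isSymmetric_green hν (w l : L2) (w l' : L2)).symm
      rw [real_inner_comm, h3] at h2
      have h4 : ((l : ℝ) - l') * ⟪green ν (w l), (w l' : L2)⟫ = 0 := by linarith
      exact (mul_eq_zero.1 h4).resolve_left (sub_ne_zero.2 fun h => hne (Subtype.ext h))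
    have hnorm : ‖u‖ ^ 2 = ∑ l : s, ‖(w l : L2)‖ ^ 2 := by
      rw [← real_inner_self_eq_norm_sq, hudef, htotal, sum_inner]
      refine Finset.sum_congr rfl fun l _ => ?_
      rw [inner_sum, Finset.sum_eq_single_of_mem l (Finset.mem_univ l) fun l' _ hne => ?_,
        real_inner_self_eq_norm_sq]
      rw [hww, horth l l' hne.symm, mul_zero]
    have hform : ⟪green ν u, u⟫ = ∑ l : s, ⟪green ν (w l), (w l : L2)⟫ := by
      rw [hudef, htotal, map_sum, sum_inner]
      refine Finset.sum_congr rfl fun l _ => ?_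
      rw [inner_sum, Finset.sum_eq_single_of_mem l (Finset.mem_univ l) fun l' _ hne => ?_]
      exact horth l l' hne.symm
    have hpos : ∀ v : L2, 0 ≤ ⟪green ν v, v⟫ := fun v => by
      rw [inner_green hν]; exact integral_nonneg fun y => mul_self_nonneg _
    have hle : ‖u‖ ^ 2 ≤ x * ⟪green ν u, u⟫ := by
      rw [hnorm, hform, Finset.mul_sum]
      refine Finset.sum_le_sum fun l _ => ?_
      rw [← real_inner_self_eq_norm_sq, hww]
      exact mul_le_mul_of_nonneg_right (hs l l.2) (hpos _)
    have hu0 : ‖u‖ ^ 2 = 0 := by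
      have h1 : ‖u‖ ^ 2 ≤ x * d ^ 2 * ‖u‖ ^ 2 :=
        (hle.trans (mul_le_mul_of_nonneg_left hgu hx0)).trans_eq (by ring)
      nlinarith [sq_nonneg ‖u‖]
    rw [hnorm, Finset.sum_eq_zero_iff_of_nonneg fun _ _ => sq_nonneg _] at hu0
    funext l
    exact Subtype.ext (norm_eq_zero.1 (pow_eq_zero_iff two_ne_zero |>.1 (hu0 l (Finset.mem_univ l))))
  have hfin : Module.Finite ℝ (∀ l : s, eigenDerivs ν l) := Module.Finite.of_injective Φ hinj
  have hfin' : ∀ l : s, Module.Finite ℝ (eigenDerivs ν l) := fun l =>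
    Module.Finite.of_surjective (LinearMap.proj l : (∀ l : s, eigenDerivs ν l) →ₗ[ℝ] _)
      (LinearMap.proj_surjective l)
  have hrank := LinearMap.finrank_le_finrank_of_injective hinj
  rw [Module.finrank_pi_fintype, Module.finrank_fintype_fun_eq_card, Fintype.card_fin] at hrank
  rw [← Finset.sum_coe_sort]
  calc ∑ l : s, multiplicity ν l
      ≤ ∑ l : s, ((Module.finrank ℝ (eigenDerivs ν l) : ℕ) : ℕ∞) :=
        Finset.sum_le_sum fun l _ => (multiplicity_le hν l).trans_eq (by
          rw [← Module.finrank_eq_rank, map_natCast])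
    _ ≤ ((m + 2 : ℕ) : ℕ∞) := by rw [← Nat.cast_sum]; exact_mod_cast hrank

theorem eigenvalueCount_le {ν : Measure ℝ} [IsFiniteMeasure ν] (hν : ν (Ioo (0 : ℝ) 1)ᶜ = 0)
    {m : ℕ} (hm : 0 < m) {x : ℝ} (hx0 : 0 ≤ x) (hx : x * ((ν.real univ + 1) / m) ^ 2 < 1) :
    eigenvalueCount ν x ≤ ((m + 2 : ℕ) : ℝ≥0∞) := by
  rw [eigenvalueCount, ENNReal.tsum_eq_iSup_sum]
  refine iSup_le fun s => ?_
  have h := sum_multiplicity_le hν hm hx0 hx (s := s.map (Function.Embedding.subtype _))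
    (by simp only [Finset.mem_map]; rintro l ⟨l', -, rfl⟩; exact l'.2)
  rw [Finset.sum_map] at h
  have h2 := ENat.toENNReal_mono h
  rw [← ENat.toENNRealRingHom_apply, map_sum] at h2
  simpa using h2

/-! ### The lower bound for the eigenvalue counting function -/

section Lower

variable {ν : Measure ℝ} [IsFiniteMeasure ν]

/-- Since `e = μ⁻¹ • green ν e`, it inherits zero mean and affinity off the support from the range
of `green ν`. -/
theorem isEigenfunction_primitive (hν : ν (Ioo (0 : ℝ) 1)ᶜ = 0) {e : L2} (he : e ≠ 0) {μ : ℝ}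
    (hμ : μ ≠ 0) (h : green ν e = μ • e) : IsEigenfunction ν μ⁻¹ (primitive e) := by
  have he' : e = μ⁻¹ • green ν e := by rw [h, smul_smul, inv_mul_cancel₀ hμ, one_smul]
  have hmean : ⟪ind 1, e⟫ = 0 := by
    rw [he', real_inner_smul_right, inner_one_green hν, mul_zero]
  refine ⟨⟨primitive_mem_H10 hmean, ?_⟩, fun h0 => ?_, ?_⟩
  · rw [he', map_smul]
    exact (affineOffSupport_primitive_green hν e).smul _
  · have h1 := integral_primitive_mul hν e e
    rw [h0, h, real_inner_smul_left] at h1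
    simp [hμ, he] at h1
  · rintro g ⟨hg, -⟩
    obtain ⟨v, hv, rfl⟩ := exists_primitive_eq hg
    rw [energy_primitive hmean hv, integral_primitive_mul hν, ← real_inner_smul_left, ← he']

theorem card_le_multiplicity (hν : ν (Ioo (0 : ℝ) 1)ᶜ = 0) {b : Finset L2}
    (hb : LinearIndependent ℝ (Subtype.val : b → L2)) {μ : ℝ} (hμ : μ ≠ 0)
    (h : ∀ e ∈ b, green ν e = μ • e) : (b.card : ℕ∞) ≤ multiplicity ν μ⁻¹ := by
  -- `primitive` kills constants, but on the `μ`-eigenspace it is injective: `∫ (primitive w)² dν =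
  -- μ ‖w‖²`.
  have hker : Disjoint (Submodule.span ℝ (range (Subtype.val : b → L2))) primitive.ker := by
    rw [Submodule.disjoint_def]
    intro w hw hw0
    have hgw : green ν w = μ • w := by
      clear hw0
      induction hw using Submodule.span_induction with
      | mem x hx => obtain ⟨e, rfl⟩ := hx; exact h e e.2
      | zero => simp
      | add x y _ _ hx hy => rw [map_add, hx, hy, smul_add]
      | smul a x _ hx => rw [map_smul, hx, smul_comm]
    have h1 := integral_primitive_mul hν w w
    rw [LinearMap.mem_ker.1 hw0, hgw, real_inner_smul_left] at h1
    simpa [hμ] using h1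
  have hli := hb.map hker
  let f : b → Submodule.span ℝ {f | IsEigenfunction ν μ⁻¹ f} := fun e =>
    ⟨primitive e, Submodule.subset_span
      (isEigenfunction_primitive hν (hb.ne_zero e) hμ (h e e.2))⟩
  have hf : LinearIndependent ℝ f :=
    LinearIndependent.of_comp (Submodule.subtype _) hli
  have := Cardinal.toENat.monotone' hf.cardinal_le_rank
  simpa [multiplicity] using this

theorem card_le_eigenvalueCount (hν : ν (Ioo (0 : ℝ) 1)ᶜ = 0) {b : Finset L2}
    (hb : LinearIndependent ℝ (Subtype.val : b → L2)) {c : ℝ} (hc : 0 < c)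
    (h : ∀ e ∈ b, ∃ μ > c, green ν e = μ • e) {x : ℝ} (hx : c⁻¹ ≤ x) :
    (b.card : ℝ≥0∞) ≤ eigenvalueCount ν x := by
  classical
  choose! μ hμc hμ using h
  have hle : ∀ e ∈ b, (μ e)⁻¹ ≤ x := fun e he => (inv_anti₀ hc (hμc e he).le).trans hx
  -- The eigenvectors are grouped by eigenvalue; each fibre of `g` is bounded by one multiplicity.
  let g : b → Iic x := fun e => ⟨(μ e)⁻¹, hle e e.2⟩
  have hcard : b.card = ∑ l ∈ Finset.univ.image g, (Finset.univ.filter (fun e => g e = l)).card := by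
    rw [← Finset.card_eq_sum_card_image]; simp
  rw [hcard, eigenvalueCount, Nat.cast_sum]
  refine (Finset.sum_le_sum fun l hl => ?_).trans (ENNReal.sum_le_tsum (Finset.univ.image g))
  obtain ⟨e₀, -, rfl⟩ := Finset.mem_image.1 hl
  let b' : Finset L2 := (Finset.univ.filter (fun e => g e = g e₀)).map (Function.Embedding.subtype _)
  have hb'sub : ∀ e ∈ b', e ∈ b ∧ μ e = μ e₀ := by
    intro e he
    obtain ⟨e', he', rfl⟩ := Finset.mem_map.1 he
    refine ⟨e'.2, inv_injective ?_⟩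
    exact congrArg Subtype.val (Finset.mem_filter.1 he').2
  have hli : LinearIndependent ℝ (Subtype.val : b' → L2) :=
    hb.comp (fun e : b' => (⟨e, (hb'sub e e.2).1⟩ : b)) fun e e' hee =>
      Subtype.ext (congrArg (fun z : b => (z : L2)) hee)
  have := card_le_multiplicity hν hli (μ := μ e₀) (hc.trans (hμc e₀ e₀.2)).ne' fun e he => by
    obtain ⟨h1, h2⟩ := hb'sub e he
    rw [← h2]; exact hμ e h1
  rw [Finset.card_map] at this
  exact_mod_cast ENat.toENNReal_mono this

/-- The derivative of the tent function on `[a,b]`. -/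
noncomputable def tentDeriv (a b : ℝ) : L2 := (2 : ℝ) • kern ((a + b) / 2) - kern a - kern b

/-- In this second difference of Green functions the bilinear terms cancel, because the poles
satisfy `2 · (a + b)/2 = a + b`. -/
theorem inner_kern_tentDeriv {a b y : ℝ} (hab : a ≤ b) (ha : 0 ≤ a) (hb : b ≤ 1)
    (hy : y ∈ Icc (0 : ℝ) 1) : ⟪kern y, tentDeriv a b⟫ = max 0 (min (y - a) (b - y)) := by
  rw [tentDeriv, inner_sub_right, inner_sub_right, real_inner_smul_right,
    inner_kern_kern hy ⟨by linarith, by linarith⟩, inner_kern_kern hy ⟨ha, by linarith⟩,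
    inner_kern_kern hy ⟨by linarith, hb⟩]
  rcases le_total y a with h1 | h1
  · rw [min_eq_left h1, min_eq_left (by linarith), min_eq_left (by linarith),
      min_eq_left (by linarith), max_eq_left (by linarith)]
    ring
  rcases le_total y b with h2 | h2
  · rw [min_eq_right h1, min_eq_left h2]
    rcases le_total y ((a + b) / 2) with h3 | h3
    · rw [min_eq_left h3, min_eq_left (by linarith), max_eq_right (by linarith)]; ring
    · rw [min_eq_right h3, min_eq_right (by linarith), max_eq_right (by linarith)]; ring
  · rw [min_eq_right h1, min_eq_right h2, min_eq_right (by linarith), min_eq_right (by linarith),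
      max_eq_left (by linarith)]
    ring

theorem inner_tentDeriv_eq (a b : ℝ) (u : L2) :
    ⟪tentDeriv a b, u⟫ = 2 * ⟪kern ((a + b) / 2), u⟫ - ⟪kern a, u⟫ - ⟪kern b, u⟫ := by
  rw [tentDeriv, inner_sub_left, inner_sub_left, real_inner_smul_left]

theorem norm_sq_tentDeriv {a b : ℝ} (hab : a ≤ b) (ha : 0 ≤ a) (hb : b ≤ 1) :
    ‖tentDeriv a b‖ ^ 2 = b - a := by
  rw [← real_inner_self_eq_norm_sq, inner_tentDeriv_eq,
    inner_kern_tentDeriv hab ha hb ⟨by linarith, by linarith⟩,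
    inner_kern_tentDeriv hab ha hb ⟨ha, by linarith⟩,
    inner_kern_tentDeriv hab ha hb ⟨by linarith, hb⟩, sub_self, sub_self,
    min_eq_left (by linarith), min_eq_left (by linarith), min_eq_right (by linarith),
    max_eq_right (by linarith), max_self]
  ring

theorem inner_kern_tentDeriv_eq_zero {a b y : ℝ} (hab : a ≤ b) (ha : 0 ≤ a) (hb : b ≤ 1)
    (hy : y ∈ Icc (0 : ℝ) 1) (h : y ∉ Ioo a b) : ⟪kern y, tentDeriv a b⟫ = 0 := by
  rw [inner_kern_tentDeriv hab ha hb hy, max_eq_left]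
  by_contra! h'
  rw [lt_min_iff] at h'
  exact h ⟨by linarith, by linarith⟩

theorem inner_tentDeriv_tentDeriv {a b a' b' : ℝ} (hab : a ≤ b) (ha : 0 ≤ a) (hb : b ≤ a')
    (hab' : a' ≤ b') (hb' : b' ≤ 1) : ⟪tentDeriv a b, tentDeriv a' b'⟫ = 0 := by
  have key : ∀ y, 0 ≤ y → y ≤ b → ⟪kern y, tentDeriv a' b'⟫ = 0 := fun y h0 h1 =>
    inner_kern_tentDeriv_eq_zero hab' (by linarith) hb' ⟨h0, by linarith⟩
      fun h => by linarith [h.1]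
  rw [inner_tentDeriv_eq, key _ (by linarith) (by linarith), key a ha hab,
    key b (by linarith) le_rfl]
  ring

theorem inner_green_tentDeriv_tentDeriv (hν : ν (Ioo (0 : ℝ) 1)ᶜ = 0) {a b a' b' : ℝ}
    (hab : a ≤ b) (ha : 0 ≤ a) (hb : b ≤ a') (hab' : a' ≤ b') (hb' : b' ≤ 1) :
    ⟪green ν (tentDeriv a b), tentDeriv a' b'⟫ = 0 := by
  rw [inner_green hν]
  refine integral_eq_zero_of_ae ?_
  filter_upwards [ae_mem_Icc hν] with y hy
  by_cases h : y ∈ Ioo a b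
  · rw [inner_kern_tentDeriv_eq_zero hab' (by linarith) hb' hy fun h' => by linarith [h.2, h'.1]]
    simp
  · rw [inner_kern_tentDeriv_eq_zero hab ha (by linarith) hy h]
    simp

theorem le_inner_green_tentDeriv (hν : ν (Ioo (0 : ℝ) 1)ᶜ = 0) {E : Set ℝ} {c : ℝ} (hc : 0 < c)
    (h : ∀ B, MeasurableSet B → c * volume.real (B ∩ E) ≤ ν.real B) {a b δ : ℝ}
    (hab : a ≤ b) (ha : 0 ≤ a) (hb : b ≤ 1) (hδ : 0 ≤ δ)
    (hE : δ / 2 * (b - a) ≤ volume.real (Icc a b ∩ E)) :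
    c * δ ^ 3 / 256 * (b - a) ^ 3 ≤ ⟪green ν (tentDeriv a b), tentDeriv a b⟫ := by
  -- Trimming `τ` at both ends costs at most half of the guaranteed measure of `E`, and on the rest
  -- the tent is at least `τ`; the constant is `256 = 4 · 8²`.
  set τ := δ * (b - a) / 8 with hτdef
  have hτ : 0 ≤ τ := by have := sub_nonneg.2 hab; positivity
  have hfin : ∀ p q : ℝ, volume (Icc p q ∩ E) ≠ ∞ := fun p q =>
    ne_top_of_le_ne_top (by simp) (measure_mono inter_subset_left)
  have hmid : δ / 4 * (b - a) ≤ volume.real (Icc (a + τ) (b - τ) ∩ E) := by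
    have hsub : Icc a b ∩ E ⊆ (Icc (a + τ) (b - τ) ∩ E) ∪ (Icc a (a + τ) ∪ Icc (b - τ) b) := by
      rintro x ⟨hx, hxE⟩
      by_cases h1 : x < a + τ
      · exact Or.inr (Or.inl ⟨hx.1, h1.le⟩)
      by_cases h2 : b - τ < x
      · exact Or.inr (Or.inr ⟨h2.le, hx.2⟩)
      · exact Or.inl ⟨⟨not_lt.1 h1, not_lt.1 h2⟩, hxE⟩
    have h1 := (measureReal_mono hsub (measure_union_ne_top (hfin _ _)
      (measure_union_ne_top (by simp) (by simp)))).trans (measureReal_union_le (μ := volume) _ _)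
    have h2 := measureReal_union_le (μ := volume) (Icc a (a + τ)) (Icc (b - τ) b)
    rw [Real.volume_real_Icc_of_le (by linarith), Real.volume_real_Icc_of_le (by linarith)] at h2
    linarith
  have hν' := h (Icc (a + τ) (b - τ)) measurableSet_Icc
  have hint : ∫ y, (Icc (a + τ) (b - τ)).indicator (fun _ => τ ^ 2) y ∂ν
      ≤ ⟪green ν (tentDeriv a b), tentDeriv a b⟫ := by
    rw [inner_green hν]
    refine integral_mono_ae ((integrable_const _).indicator measurableSet_Icc)
      (integrable_inner_kern_mul hν _ _) ?_
    filter_upwards [ae_mem_Icc hν] with y hy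
    by_cases hy' : y ∈ Icc (a + τ) (b - τ)
    · rw [indicator_of_mem hy', ← sq, inner_kern_tentDeriv hab ha hb hy]
      have : τ ≤ max 0 (min (y - a) (b - y)) :=
        le_max_of_le_right (le_min (by linarith [hy'.1]) (by linarith [hy'.2]))
      gcongr
    · rw [indicator_of_notMem hy']; exact mul_self_nonneg _
  rw [integral_indicator_const _ measurableSet_Icc, smul_eq_mul] at hint
  calc c * δ ^ 3 / 256 * (b - a) ^ 3 = c * (δ / 4 * (b - a)) * τ ^ 2 := by rw [hτdef]; ring
    _ ≤ c * volume.real (Icc (a + τ) (b - τ) ∩ E) * τ ^ 2 := by gcongr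
    _ ≤ ν.real (Icc (a + τ) (b - τ)) * τ ^ 2 := by gcongr
    _ ≤ _ := hint

open Classical in
/-- The indices of the cells of the uniform partition of `[0,1]` into `n` cells in which `E` has
relative measure at least `δ / 2`. -/
noncomputable def denseCells (E : Set ℝ) (δ : ℝ) (n : ℕ) : Finset ℕ :=
  (Finset.range n).filter fun i =>
    δ / 2 * ((n : ℝ)⁻¹) ≤ volume.real (Icc ((i : ℝ) / n) (((i + 1 : ℕ) : ℝ) / n) ∩ E)

/-- Sparse cells carry at most half of `Λ(E)` in total, and each dense cell at most `1/n`. -/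
theorem le_card_denseCells {E : Set ℝ} (hE : E ⊆ Ioo 0 1) {n : ℕ} (hn : 0 < n) :
    volume.real E / 2 * n ≤ (denseCells E (volume.real E) n).card := by
  classical
  have hn' : (0 : ℝ) < n := by exact_mod_cast hn
  set δ := volume.real E
  set v : ℕ → ℝ := fun i => volume.real (Icc ((i : ℝ) / n) (((i + 1 : ℕ) : ℝ) / n) ∩ E)
  have hδ : δ ≤ ∑ i ∈ Finset.range n, v i := by
    refine (measureReal_mono
      (s₂ := ⋃ i ∈ Finset.range n, Icc ((i : ℝ) / n) (((i + 1 : ℕ) : ℝ) / n) ∩ E) ?_ ?_).trans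
      (measureReal_biUnion_finset_le _ _)
    · intro x hx
      have hx01 := hE hx
      have hxn : 0 ≤ x * n := by have := hx01.1; positivity
      refine mem_iUnion₂.2 ⟨⌊x * n⌋₊, ?_, ⟨?_, ?_⟩, hx⟩
      · rw [Finset.mem_range, Nat.floor_lt hxn]
        nlinarith [hx01.2]
      · rw [div_le_iff₀ hn']; exact Nat.floor_le hxn
      · rw [le_div_iff₀ hn']; push_cast; exact (Nat.lt_floor_add_one _).le
    · rw [← iUnion₂_inter]
      exact ne_top_of_le_ne_top (by simp : volume (Ioo (0 : ℝ) 1) ≠ ∞)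
        (measure_mono (inter_subset_right.trans hE))
  have hv : ∀ i, v i ≤ (n : ℝ)⁻¹ := fun i => by
    refine (measureReal_mono inter_subset_left (by simp)).trans_eq ?_
    rw [Real.volume_real_Icc_of_le (by gcongr; linarith)]
    push_cast; field_simp; ring
  have hsum : ∑ i ∈ Finset.range n, v i ≤
      ∑ i ∈ Finset.range n, (δ / 2 * (n : ℝ)⁻¹ + if i ∈ denseCells E δ n then (n : ℝ)⁻¹ else 0) := by
    refine Finset.sum_le_sum fun i hi => ?_
    have hδ0 : 0 ≤ δ / 2 * (n : ℝ)⁻¹ := by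
      have : 0 ≤ δ := measureReal_nonneg
      positivity
    split_ifs with h
    · linarith [hv i]
    · rw [denseCells, Finset.mem_filter, not_and] at h
      linarith [not_le.1 (h hi)]
  have hsub : denseCells E δ n ⊆ Finset.range n := Finset.filter_subset _ _
  rw [Finset.sum_add_distrib, Finset.sum_const, Finset.card_range, nsmul_eq_mul,
    Finset.sum_ite_mem, Finset.inter_eq_right.2 hsub, Finset.sum_const, nsmul_eq_mul] at hsum
  have h1 : (n : ℝ) * (δ / 2 * (n : ℝ)⁻¹) = δ / 2 := by field_simp
  rw [h1] at hsum
  have h2 : δ / 2 ≤ (denseCells E δ n).card * (n : ℝ)⁻¹ := by linarith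
  rwa [← div_eq_mul_inv, le_div_iff₀ hn'] at h2

theorem sum_inner_eq_of_pairwise {ι H : Type*} [Fintype ι] [NormedAddCommGroup H]
    [InnerProductSpace ℝ H] (T : H →L[ℝ] H) (u : ι → H)
    (h : ∀ i j, i ≠ j → ⟪T (u i), u j⟫ = 0) (a : ι → ℝ) :
    ⟪T (∑ i, a i • u i), ∑ i, a i • u i⟫ = ∑ i, a i ^ 2 * ⟪T (u i), u i⟫ := by
  rw [map_sum, sum_inner]
  refine Finset.sum_congr rfl fun i _ => ?_
  rw [inner_sum, Finset.sum_eq_single_of_mem i (Finset.mem_univ i) fun j _ hne => ?_, map_smul,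
    real_inner_smul_left, real_inner_smul_right]
  · ring
  · rw [map_smul, real_inner_smul_left, real_inner_smul_right, h i j hne.symm, mul_zero, mul_zero]

theorem le_eigenvalueCount (hν : ν (Ioo (0 : ℝ) 1)ᶜ = 0) {E : Set ℝ} (hE : E ⊆ Ioo 0 1)
    (hE0 : 0 < volume.real E) {c : ℝ} (hc : 0 < c)
    (h : ∀ B, MeasurableSet B → c * volume.real (B ∩ E) ≤ ν.real B) {n : ℕ} (hn : 0 < n) {x : ℝ}
    (hx : 512 / (c * volume.real E ^ 3) * (n : ℝ) ^ 2 ≤ x) :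
    ENNReal.ofReal (volume.real E / 2 * n) ≤ eigenvalueCount ν x := by
  set δ := volume.real E
  have hn' : (0 : ℝ) < n := by exact_mod_cast hn
  set J := denseCells E δ n
  let u : J → L2 := fun i => tentDeriv ((i : ℕ) / n) (((i + 1 : ℕ) : ℝ) / n)
  have hlen : ∀ i : ℕ, ((i + 1 : ℕ) : ℝ) / n - (i : ℝ) / n = (n : ℝ)⁻¹ := fun i => by
    push_cast; field_simp; ring
  have h0 : ∀ i : ℕ, (0 : ℝ) ≤ (i : ℝ) / n := fun i => by positivity
  have hle : ∀ i : ℕ, (i : ℝ) / n ≤ ((i + 1 : ℕ) : ℝ) / n := fun i => by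
    gcongr; simp
  have h1 : ∀ i : J, (((i : ℕ) + 1 : ℕ) : ℝ) / n ≤ 1 := fun i => by
    have : (i : ℕ) < n := Finset.mem_range.1 (Finset.filter_subset _ _ i.2)
    rw [div_le_one hn']
    exact_mod_cast this
  have hstep : ∀ {i j : ℕ}, i < j → ((i + 1 : ℕ) : ℝ) / n ≤ (j : ℝ) / n := fun {i j} hij => by
    gcongr; exact hij
  have hort : ∀ i j, i ≠ j → ⟪(ContinuousLinearMap.id ℝ L2) (u i), u j⟫ = 0 := by
    intro i j hij
    rcases lt_or_gt_of_ne hij with hlt | hlt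
    · exact inner_tentDeriv_tentDeriv (hle _) (h0 _) (hstep hlt) (hle _) (h1 j)
    · rw [real_inner_comm]
      exact inner_tentDeriv_tentDeriv (hle _) (h0 _) (hstep hlt) (hle _) (h1 i)
  have hortg : ∀ i j, i ≠ j → ⟪green ν (u i), u j⟫ = 0 := by
    intro i j hij
    rcases lt_or_gt_of_ne hij with hlt | hlt
    · exact inner_green_tentDeriv_tentDeriv hν (hle _) (h0 _) (hstep hlt) (hle _) (h1 j)
    · have := isSymmetric_green hν (u i) (u j)
      rw [ContinuousLinearMap.coe_coe] at this
      rw [this, real_inner_comm]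
      exact inner_green_tentDeriv_tentDeriv hν (hle _) (h0 _) (hstep hlt) (hle _) (h1 i)
  -- Half of the bound for the Rayleigh quotient of a tent, to get the strict inequality needed for
  -- the variational lemma.
  set c₀ := c * δ ^ 3 / 512 * (n : ℝ)⁻¹ ^ 2 with hc₀def
  have hc₀ : 0 < c₀ := by positivity
  have hform : ∀ a : J → ℝ, a ≠ 0 →
      c₀ * ‖∑ i, a i • u i‖ ^ 2 < ⟪green ν (∑ i, a i • u i), ∑ i, a i • u i⟫ := by
    intro a ha
    have e := sum_inner_eq_of_pairwise (ContinuousLinearMap.id ℝ L2) u hort a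
    simp only [ContinuousLinearMap.id_apply, real_inner_self_eq_norm_sq] at e
    rw [e, sum_inner_eq_of_pairwise (green ν) u hortg a, Finset.mul_sum]
    have hlt : ∀ i : J, c₀ * ‖u i‖ ^ 2 < ⟪green ν (u i), u i⟫ := fun i => by
      refine lt_of_lt_of_le ?_ (le_inner_green_tentDeriv hν hc h (hle i) (h0 i) (h1 i) hE0.le ?_)
      · simp only [u]
        rw [norm_sq_tentDeriv (hle i) (h0 i) (h1 i), hlen, hc₀def]
        have : 0 < c * δ ^ 3 * (n : ℝ)⁻¹ ^ 3 := by positivity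
        linarith
      · rw [hlen]
        classical
        exact (Finset.mem_filter.1 i.2).2
    obtain ⟨i, hi⟩ := Function.ne_iff.1 ha
    have hi' : 0 < a i ^ 2 := by have : a i ≠ 0 := hi; positivity
    refine Finset.sum_lt_sum (fun j _ => ?_) ⟨i, Finset.mem_univ i, ?_⟩
    · have := mul_le_mul_of_nonneg_left (hlt j).le (sq_nonneg (a j))
      linarith
    · have := mul_lt_mul_of_pos_left (hlt i) hi'
      linarith
  obtain ⟨b, hbcard, hbli, hb⟩ := exists_linearIndependent_eigenvectors (isCompactOperator_green hν)
    (isSymmetric_green hν) u hform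
  have hx' : c₀⁻¹ ≤ x := by
    refine le_trans (le_of_eq ?_) hx
    rw [hc₀def]; field_simp
  refine le_trans ?_ (card_le_eigenvalueCount hν hbli hc₀ hb hx')
  rw [hbcard, Fintype.card_coe, ← ENNReal.ofReal_natCast]
  exact ENNReal.ofReal_le_ofReal (le_card_denseCells hE hn)

end Lower

/-! ### The spectral dimension -/

theorem hasSpectralDim {ν : Measure ℝ} [IsFiniteMeasure ν] (hν : ν (Ioo (0 : ℝ) 1)ᶜ = 0)
    (hac : volume.withDensity (ν.rnDeriv volume) ≠ 0) : HasSpectralDim ν (1 / 2) := by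
  obtain ⟨E, hE, -, hE0, c, hc, h⟩ := exists_lebesgue_minorant ν hν hac
  set δ := volume.real E
  set K := 512 / (c * δ ^ 3)
  have hK : 0 < K := by positivity
  set M := ν.real univ
  have hM : 0 ≤ M := measureReal_nonneg
  have hlower : ∀ᶠ x : ℝ in atTop,
      ENNReal.ofReal (δ / (4 * √K) * √x) ≤ eigenvalueCount ν x := by
    filter_upwards [eventually_ge_atTop K, eventually_gt_atTop 0] with x hxK hx0
    have h1 : 1 ≤ √(x / K) := by
      rw [Real.one_le_sqrt, le_div_iff₀ hK]; linarith
    -- The largest `n` with `K n² ≤ x`; rounding down loses at most a factor `2` since `√(x / K) ≥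
    -- 1`.
    have hn : 0 < ⌊√(x / K)⌋₊ := Nat.floor_pos.2 h1
    have hn1 : (1 : ℝ) ≤ ⌊√(x / K)⌋₊ := by exact_mod_cast hn
    have hle : (⌊√(x / K)⌋₊ : ℝ) ≤ √(x / K) := Nat.floor_le (by positivity)
    refine le_trans (ENNReal.ofReal_le_ofReal ?_) (le_eigenvalueCount hν hE hE0 hc h hn (x := x) ?_)
    · have h2 : √(x / K) ≤ 2 * ⌊√(x / K)⌋₊ := by
        have := Nat.lt_floor_add_one √(x / K)
        linarith
      have h3 : δ / (4 * √K) * √x = δ / 4 * √(x / K) := by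
        rw [Real.sqrt_div hx0.le]; field_simp
      rw [h3]
      nlinarith
    · have h2 : (⌊√(x / K)⌋₊ : ℝ) ^ 2 ≤ x / K := by
        refine (pow_le_pow_left₀ (by positivity) hle 2).trans_eq ?_
        exact Real.sq_sqrt (by positivity)
      calc K * (⌊√(x / K)⌋₊ : ℝ) ^ 2 ≤ K * (x / K) := by gcongr
        _ = x := by field_simp
  have hupper : ∀ᶠ x : ℝ in atTop,
      eigenvalueCount ν x ≤ ENNReal.ofReal ((M + 5) * √x) := by
    filter_upwards [eventually_ge_atTop 1] with x hx
    have hs : 1 ≤ √x := Real.one_le_sqrt.2 hx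
    -- With `m = ⌊r⌋ + 1 > r` the condition `x ((M + 1) / m)² < 1` holds, and `m + 2 ≤ r + 3` is
    -- absorbed into `(M + 5) √x` because `√x ≥ 1`.
    set r := √x * (M + 1)
    have hr : 0 < r := by positivity
    have hm : r < (⌊r⌋₊ + 1 : ℕ) := by push_cast; exact Nat.lt_floor_add_one r
    refine (eigenvalueCount_le hν (Nat.succ_pos ⌊r⌋₊) (by linarith) (x := x) ?_).trans ?_
    · have e : x * ((M + 1) / ((⌊r⌋₊ + 1 : ℕ) : ℝ)) ^ 2 = (r / ((⌊r⌋₊ + 1 : ℕ) : ℝ)) ^ 2 := by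
        rw [div_pow, div_pow, mul_pow, Real.sq_sqrt (by linarith)]; ring
      change x * ((M + 1) / ((⌊r⌋₊ + 1 : ℕ) : ℝ)) ^ 2 < 1
      rw [e]
      have h0 : (0 : ℝ) < (⌊r⌋₊ + 1 : ℕ) := by positivity
      exact pow_lt_one₀ (by positivity) ((div_lt_one h0).2 hm) two_ne_zero
    · rw [← ENNReal.ofReal_natCast]
      refine ENNReal.ofReal_le_ofReal ?_
      have := Nat.floor_le hr.le
      push_cast
      simp only [r] at this ⊢
      nlinarith
  have hlim : ∀ C : ℝ, 0 < C → Tendsto (fun x : ℝ =>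
      ((Real.log (C * √x) / Real.log x : ℝ) : EReal)) atTop (𝓝 ((1 / 2 : ℝ) : EReal)) := by
    intro C hC
    refine (continuous_coe_real_ereal.tendsto _).comp ?_
    have h1 : Tendsto (fun x : ℝ => Real.log C / Real.log x + 1 / 2) atTop (𝓝 (1 / 2)) := by
      simpa only [zero_add] using
        (Real.tendsto_log_atTop.const_div_atTop (Real.log C)).add_const (1 / 2 : ℝ)
    refine h1.congr' ?_
    filter_upwards [eventually_gt_atTop 1] with x hx
    have := Real.log_pos hx
    rw [Real.log_mul hC.ne' (by positivity), Real.log_sqrt (by linarith)]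
    field_simp
  have hmono : ∀ {x : ℝ} {p q : ℝ≥0∞}, 1 < x → p ≤ q →
      ENNReal.log p / ((Real.log x : ℝ) : EReal) ≤ ENNReal.log q / ((Real.log x : ℝ) : EReal) := by
    intro x p q hx hpq
    exact EReal.div_le_div_right_of_nonneg (by exact_mod_cast (Real.log_pos hx).le)
      (ENNReal.log_monotone hpq)
  have hT : Tendsto (fun x : ℝ => ENNReal.log (eigenvalueCount ν x) / ((Real.log x : ℝ) : EReal))
      atTop (𝓝 ((1 / 2 : ℝ) : EReal)) := by
    refine tendsto_of_tendsto_of_tendsto_of_le_of_le' (hlim (δ / (4 * √K)) (by positivity))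
      (hlim (M + 5) (by positivity)) ?_ ?_
    · filter_upwards [hlower, eventually_gt_atTop 1] with x hx hx1
      refine le_trans (le_of_eq ?_) (hmono hx1 hx)
      have : 0 < x := by linarith
      rw [EReal.coe_div, ENNReal.log_ofReal_of_pos (by positivity)]
    · filter_upwards [hupper, eventually_gt_atTop 1] with x hx hx1
      refine (hmono hx1 hx).trans (le_of_eq ?_)
      have : 0 < x := by linarith
      rw [EReal.coe_div, ENNReal.log_ofReal_of_pos (by positivity)]
  exact ⟨hT.liminf_eq, hT.limsup_eq⟩

end KreinFeller

theorem corollary1p3 (ν : MeasureTheory.Measure ℝ) [MeasureTheory.IsFiniteMeasure ν]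
    (hν : ν (Set.Ioo (0 : ℝ) 1)ᶜ = 0)
    (hac : MeasureTheory.volume.withDensity (ν.rnDeriv MeasureTheory.volume) ≠ 0) :
    (∀ q ∈ Set.Icc (0 : ℝ) 1,
      Filter.Tendsto (fun n : ℕ => KreinFeller.betaLevel ν n q) Filter.atTop (nhds (1 - q)) ∧
        KreinFeller.lqSpectrum ν q = ((1 - q : ℝ) : EReal)) ∧
    KreinFeller.IsLqRegular ν ∧
    KreinFeller.HasSpectralDim ν (1 / 2) :=
  ⟨fun _ hq => ⟨KreinFeller.tendsto_betaLevel hν hac hq,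
    (KreinFeller.tendsto_coe_betaLevel hν hac hq).limsup_eq⟩,
    KreinFeller.isLqRegular hν hac, KreinFeller.hasSpectralDim hν hac⟩
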